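/- **Setting.** There are $n\ge1$ agents and $m\ge1$ item types; $v_{i,j}$ is the (unknown) expected value of an item of type $j$ for agent $i$. In each round $t=1,\dots,T$ an item of type $j(t)$ arrives, drawn independently of the past with $\Pr[j(t)=j]=s_j$, and is given to an agent $i(t)$, who obtains the utility $u(t)=v_{i(t),j(t)}+\varepsilon_t$. The noise $\varepsilon_t$ is sub-Gaussian with radius $\sigma^2$: given the past, $j(t)$ and $i(t)$, $\mathbb E[e^{\lambda\varepsilon_t}]\le e^{\lambda^2\sigma^2/2}$ for all $\lambda\in\mathbb R$. Let $U_i(T)=\sum_{t\le T:\,i(t)=i}u(t)$. For weights $B_i>0$ with $\sum_iB_i=1$ let $\mathrm{NSW}(T)=\prod_i \max(U_i(T),0)^{B_i}$, let $\mathrm{ONSW}$ be the maximum of $\prod_i\big(\sum_j s_jv_{i,j}x_{i,j}\big)^{B_i}$ over all $x_{i,j}\ge0$ with $\sum_i x_{i,j}\le1$ for every $j$, and let $\mathrm{Regret}(T)=T\cdot\mathrm{ONSW}-\mathrm{NSW}(T)$. **Algorithm DA-EtC** with parameters $l,h,\delta_0>0$ and exploration length $1\le T_0\le T$. In rounds $t\le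 T_0$ the item goes to an agent chosen uniformly at random, independently of the past and of $j(t)$. Then $\hat v_{i,j}$ is the average of the utilities that agent $i$ obtained from items of type $j$ in these rounds ($0$ if there are none). Put $\bar u_i(1)=0$. In round $t=T_0+t'$, $t'\ge1$, let $\beta_i$ be the projection of $B_i/\bar u_i(t')$ onto $\big[\tfrac{B_i}{h(1+\delta_0)},\tfrac{1+\delta_0}{l}\big]$ (where $B_i/0=+\infty$); the item goes to an agent $i(t)$ that maximizes $\beta_i\hat v_{i,j(t)}$, ties being broken by any rule that does not look into the future; and $\bar u_i(t'+1)=\frac{t'-1}{t'}\bar u_i(t')+\frac1{t'}\mathbb 1[i=i(t)]\,\hat v_{i,j(t)}$. For a number $w>0$ put $$C^{DA}(w)=\frac{w^2(1+\delta_0)^6}{l^4(\min_iB_i)^4}\Big(\frac{h^3w^2}{l\,\delta_0^2}+h^4\Big);$$ here $w$ stands for the largest value $\max_{i,j}\hat v_{i,j}$ that is fed into dual averaging. **Theorem 1 (Regret upper bound of DA-EtC).** Assume $B_i=1/n$, $s_j=1/m$ and $2l\le v_{i,j}\le h/2$ for all $i,j$. There is an absolute constant $p$, and there is a constant $K$ that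 depends only on $l,h,\sigma$, such that the following hold. 1. If $T_0$ is so large that $$\sqrt{\frac{8\max(1,\sigma^2)\,nm\log(nmT)}{T_0}}\le\frac{\min(1,2l)}2,$$ then the regret is integrable and, for every $w\in[l,h]$, $$\mathbb E[\mathrm{Regret}(T)]\le K(1+\log T)^p\Big(T_0+\sqrt{\tfrac{nm}{T_0}}\,T+n\,C^{DA}(w)\sqrt T\Big),$$ that is, $\mathbb E[\mathrm{Regret}(T)]=\tilde O\big(T_0+\sqrt{nm/T_0}\,T+nC^{DA}\sqrt T\big)$. 2. The term $nC^{DA}\sqrt T$ is non-leading with respect to $T$: for fixed $n,m,l,h,\delta_0$, $w\in[l,h]$, $q\in\mathbb N$ and every $\epsilon>0$, if $T$ is large enough then $(1+\log T)^q\,n\,C^{DA}(w)\sqrt T\le\epsilon\big(T_0+\sqrt{nm/T_0}\,T\big)$ for all integers $T_0\ge1$. 3. If $T_0=T^{2/3}(nm)^{1/3}$, rounded up or down to an integer, then for all $T$ that are large enough (depending on $n,m,l,h,\sigma,\delta_0$ only) the regret is integrable and $$\mathbb E[\mathrm{Regret}(T)]\le K(1+\log T)^p\,(nm)^{1/3}T^{2/3},$$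 that is, $\mathbb E[\mathrm{Regret}(T)]=\tilde O\big((nm)^{1/3}T^{2/3}\big)$. -/

import Mathlib

open MeasureTheory ProbabilityTheory Filter

noncomputable section

namespace FairDivision

variable {n m : ℕ}

/-- Feasible fractional allocations: `x i j` is the fraction of the items of type `j` given to
agent `i`. -/
def Feasible (x : Fin n → Fin m → ℝ) : Prop :=
  (∀ j, ∑ i, x i j ≤ 1) ∧ ∀ i j, 0 ≤ x i j

/-- Optimal Nash social welfare per item: the optimal value of the Eisenberg-Gale program with
weights `B`, type distribution `s` and values `v`. -/
def ONSW (B : Fin n → ℝ) (s : Fin m → ℝ) (v : Fin n → Fin m → ℝ) : ℝ :=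
  sSup {r : ℝ | ∃ x : Fin n → Fin m → ℝ, Feasible x ∧
    r = ∏ i, (∑ j, s j * v i j * x i j) ^ B i}

/-- The multiplier used by dual averaging: the projection of `b / ubar` onto
`[b / (h (1 + δ₀)), (1 + δ₀) / l]`, where `b / 0 = +∞` is projected onto the right end point. -/
def multiplier (l h δ₀ b ubar : ℝ) : ℝ :=
  if ubar = 0 then (1 + δ₀) / l
  else max (b / (h * (1 + δ₀))) (min ((1 + δ₀) / l) (b / ubar))

/-- The mean virtual utilities of dual averaging, run with the fixed value matrix `vhat` on the
types `item 0, item 1, …` with winners `win 0, win 1, …`; `daMean vhat item win k i` is the mean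
utility of agent `i` after `k` rounds. -/
def daMean (vhat : Fin n → Fin m → ℝ) (item : ℕ → Fin m) (win : ℕ → Fin n) :
    ℕ → Fin n → ℝ
  | 0, _ => 0
  | k + 1, i => (k : ℝ) / (k + 1) * daMean vhat item win k i
      + 1 / (k + 1) * (if win k = i then vhat i (item k) else 0)

/-- The realized utility of the agent who receives the item of round `t` (rounds are numbered
`0, 1, …, T - 1`). -/
def utility (v : Fin n → Fin m → ℝ) (item : ℕ → Fin m) (win : ℕ → Fin n) (noise : ℕ → ℝ)
    (t : ℕ) : ℝ :=
  v (win t) (item t) + noise t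

/-- The cumulative realized utility of agent `i` over the first `T` rounds. -/
def cumUtility (v : Fin n → Fin m → ℝ) (item : ℕ → Fin m) (win : ℕ → Fin n) (noise : ℕ → ℝ)
    (T : ℕ) (i : Fin n) : ℝ :=
  ∑ t ∈ Finset.range T, if win t = i then utility v item win noise t else 0

/-- The number of items of type `j` that agent `i` received in the first `T₀` rounds. -/
def count (item : ℕ → Fin m) (win : ℕ → Fin n) (T₀ : ℕ) (i : Fin n) (j : Fin m) : ℕ :=
  ((Finset.range T₀).filter fun t => win t = i ∧ item t = j).card

/-- The empirical mean of the utilities that agent `i` obtained from items of type `j` in the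
first `T₀` rounds (`0` if there was no such item). -/
def estimator (v : Fin n → Fin m → ℝ) (item : ℕ → Fin m) (win : ℕ → Fin n) (noise : ℕ → ℝ)
    (T₀ : ℕ) (i : Fin n) (j : Fin m) : ℝ :=
  (∑ t ∈ Finset.range T₀, if win t = i ∧ item t = j then utility v item win noise t else 0)
    / (count item win T₀ i j : ℝ)

/-- Ex post Nash social welfare. A negative cumulative utility, which unbounded noise can produce
and whose fractional power is not defined, counts as `0`. -/
def NSW (B : Fin n → ℝ) (v : Fin n → Fin m → ℝ) (item : ℕ → Fin m) (win : ℕ → Fin n)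
    (noise : ℕ → ℝ) (T : ℕ) : ℝ :=
  ∏ i, (max (cumUtility v item win noise T i) 0) ^ B i

/-- Regret over `T` rounds. -/
def regret (B : Fin n → ℝ) (s : Fin m → ℝ) (v : Fin n → Fin m → ℝ) (item : ℕ → Fin m)
    (win : ℕ → Fin n) (noise : ℕ → ℝ) (T : ℕ) : ℝ :=
  T * ONSW B s v - NSW B v item win noise T

/-- The constant `C^DA` of dual averaging; `w` stands for the largest entry of the value matrix
that is fed into dual averaging. -/
def constDA (B : Fin n → ℝ) (l h δ₀ w : ℝ) : ℝ :=
  w ^ 2 * (1 + δ₀) ^ 6 / (l ^ 4 * (⨅ i, B i) ^ 4)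
    * (h ^ 3 * w ^ 2 / l * (1 / δ₀) ^ 2 + h ^ 4)

/-- The random sequences `item` (arriving types), `win` (receiving agents) and `noise` are a run of
DA-EtC (dual averaging, explore-then-commit) with exploration length `T₀` and horizon `T`, on the
instance with weights `B`, type distribution `s`, values `v` and sub-Gaussian noise of radius `σ²`.
`H t` is the history after `t` rounds; it may contain further randomization, so that ties in the
auction are broken by any rule that does not look into the future. -/
structure IsDAEtCRun (l h δ₀ σ : ℝ) (B : Fin n → ℝ) (s : Fin m → ℝ) (v : Fin n → Fin m → ℝ)
    (T₀ T : ℕ) {Ω : Type*} [mΩ : MeasurableSpace Ω] (P : Measure Ω) (H : Filtration ℕ mΩ)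
    (item : ℕ → Ω → Fin m) (win : ℕ → Ω → Fin n) (noise : ℕ → Ω → ℝ) : Prop where
  item_measurable : ∀ t < T, Measurable[H (t + 1)] (item t)
  win_measurable : ∀ t < T, Measurable[H (t + 1)] (win t)
  noise_measurable : ∀ t < T, Measurable[H (t + 1)] (noise t)
  /-- Each type is drawn from `s`, independently of the past. -/
  item_law : ∀ t < T, ∀ j, P (item t ⁻¹' {j}) = ENNReal.ofReal (s j)
  item_indep : ∀ t < T, Indep (MeasurableSpace.comap (item t) ⊤) (H t) P
  /-- The noise is sub-Gaussian, given the past and the type and the receiver of the item. -/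
  noise_integrable : ∀ t < T, ∀ c : ℝ, Integrable (fun ω => Real.exp (c * noise t ω)) P
  noise_subgaussian : ∀ t < T, ∀ c : ℝ,
    P[fun ω => Real.exp (c * noise t ω) |
        H t ⊔ MeasurableSpace.comap (item t) ⊤ ⊔ MeasurableSpace.comap (win t) ⊤]
      ≤ᵐ[P] fun _ => Real.exp (c ^ 2 * σ ^ 2 / 2)
  /-- Exploration: the item goes to an agent chosen uniformly at random. -/
  explore_law : ∀ t < T₀, t < T → ∀ i, P (win t ⁻¹' {i}) = (n : ENNReal)⁻¹
  explore_indep : ∀ t < T₀, t < T →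
    Indep (MeasurableSpace.comap (win t) ⊤) (H t ⊔ MeasurableSpace.comap (item t) ⊤) P
  /-- Exploitation: the item goes to a highest bidder, the bid of agent `k` being its current
  multiplier times its estimated value. -/
  exploit : ∀ t < T, T₀ ≤ t → ∀ᵐ ω ∂P,
    let vhat : Fin n → Fin m → ℝ :=
      estimator v (fun τ => item τ ω) (fun τ => win τ ω) (fun τ => noise τ ω) T₀
    let bid : Fin n → ℝ := fun k =>
      multiplier l h δ₀ (B k)
          (daMean vhat (fun r => item (T₀ + r) ω) (fun r => win (T₀ + r) ω) (t - T₀) k)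
        * vhat k (item t ω)
    ∀ k, bid k ≤ bid (win t ω)

/-- The random regret of a run over `T` rounds. -/
def runRegret (B : Fin n → ℝ) (s : Fin m → ℝ) (v : Fin n → Fin m → ℝ) {Ω : Type*}
    (item : ℕ → Ω → Fin m) (win : ℕ → Ω → Fin n) (noise : ℕ → Ω → ℝ) (T : ℕ) (ω : Ω) : ℝ :=
  regret B s v (fun t => item t ω) (fun t => win t ω) (fun t => noise t ω) T

end FairDivision

end

/-! The cost splits into estimation and allocation. After exploration every estimate is within `ε`,
of order `√(nm log(nmT) / T₀)`, of the truth except with probability `3 / T`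
(`measure_estimator_error_le`). The exceptional event costs at most `T` times the optimum, hence a
constant; elsewhere the relative error is at most `η = ε / (2l)`, because values are at least `2l`.

For fixed estimates, the projected multiplier is proportional to the derivative of a logarithm
continued linearly below `a = l / (n (1 + δ₀))` (`multiplier_eq`). The winner therefore maximizes a
linearized gain, and dual averaging is a Frank-Wolfe method with step `1 / (k + 1)` for the concave
potential `∑ i, smoothLog a (u i)`. The curvature is at most of order `a⁻²`, so the losses against a
fixed comparison vector add up to a logarithm only (`potential_lower_bound`). The comparison vector
is the vector of utilities of a market equilibrium for the true values; replacing the arriving type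
by its mean costs nothing in expectation, since the multipliers are known before the type is drawn.
The order `√T` comes only from the noise in the realized utilities.

The potential must then be turned into Nash welfare. If all mean utilities are at least `a`, it is
the logarithm of the welfare, and `1 + x ≤ exp x` suffices (`sub_geomMean_le`). Paths on which some
mean is below `a` are handled without estimating their probability. Equilibrium prices bound the
potential by a linear function, which yields a slack that is nonnegative on every accurate path and
small in expectation, yet at least `R / (6n)` whenever a mean is below `a`, because equilibrium
utilities are at least `2a`. A multiple `κ` of the slack, `κ` of order `n`, pays for the whole
regret of such a path (`regret_le_of_accurate`). The factor `n` in `κ` cancels against the optimum,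
which is at most `h / (2n)`, so the term `ηT` carries no extra power of `n`.

The remaining powers of `n (1 + δ₀)` are absorbed by the dual averaging constant
(`sq_le_mul_constDA`). It is non-leading because the two other terms together are at least `T ^
(2/3)` for every exploration length (`rpow_two_thirds_le`). -/

noncomputable section

namespace FairDivision

variable {n m : ℕ}

/-! ### The smoothed logarithm -/

/-- The logarithm above `a`, continued by its tangent below `a`. -/
def smoothLog (a u : ℝ) : ℝ := Real.log (max u a) + (min u a - a) / a

theorem smoothLog_of_le {a u : ℝ} (hu : a ≤ u) : smoothLog a u = Real.log u := by
  simp [smoothLog, max_eq_left hu, min_eq_right hu]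

/-- Concavity: `1 / max u a` is the derivative at `u`. The logarithmic and the linear part are
treated separately, which is possible since `max u a + min u a = u + a`. -/
theorem smoothLog_sub_le {a : ℝ} (ha : 0 < a) (u y : ℝ) :
    smoothLog a y - smoothLog a u ≤ (y - u) / max u a := by
  have hp : 0 < max y a := lt_max_of_lt_right ha
  have hq : 0 < max u a := lt_max_of_lt_right ha
  have h1 : Real.log (max y a) - Real.log (max u a) ≤ (max y a - max u a) / max u a := by
    rw [← Real.log_div hp.ne' hq.ne', sub_div, div_self hq.ne']
    exact Real.log_le_sub_one_of_pos (by positivity)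
  have h2 : (min y a - min u a) / a ≤ (min y a - min u a) / max u a := by
    rcases le_total u a with h | h
    · rw [max_eq_right h]
    · rw [max_eq_left h, min_eq_right h]
      have h3 : min y a - a ≤ 0 := sub_nonpos.2 (min_le_right _ _)
      have h4 : u⁻¹ ≤ a⁻¹ := inv_anti₀ ha h
      rw [div_eq_mul_inv, div_eq_mul_inv]
      exact mul_le_mul_of_nonpos_left h4 h3
  have h3 : y - u = (max y a - max u a) + (min y a - min u a) := by
    linarith [max_add_min y a, max_add_min u a]
  rw [h3, add_div]
  have h4 : smoothLog a y - smoothLog a u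
      = (Real.log (max y a) - Real.log (max u a)) + (min y a - min u a) / a := by
    simp only [smoothLog]; ring
  rw [h4]; exact add_le_add h1 h2

/-- The derivative `1 / max u a` is Lipschitz with constant `a⁻²`, so the error of the linearization
is quadratic. This smoothness at `0` is why the plain logarithm is not used. -/
theorem le_smoothLog_sub {a : ℝ} (ha : 0 < a) (u y : ℝ) :
    (y - u) / max u a - (y - u) ^ 2 / a ^ 2 ≤ smoothLog a y - smoothLog a u := by
  have hp : 0 < max y a := lt_max_of_lt_right ha
  have hq : 0 < max u a := lt_max_of_lt_right ha
  set p := max y a with hpd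
  set q := max u a with hqd
  have hpa : a ≤ p := le_max_right _ _
  have hqa : a ≤ q := le_max_right _ _
  have h1 : (p - q) / q - (p - q) ^ 2 / a ^ 2 ≤ Real.log p - Real.log q := by
    have h2 : 1 - q / p ≤ Real.log p - Real.log q := by
      rw [← Real.log_div hp.ne' hq.ne']
      have := Real.one_sub_inv_le_log_of_pos (show 0 < p / q by positivity)
      rwa [inv_div] at this
    have h3 : 1 - q / p = (p - q) / q - (p - q) ^ 2 / (p * q) := by
      field_simp; ring
    have h4 : (p - q) ^ 2 / (p * q) ≤ (p - q) ^ 2 / a ^ 2 := by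
      apply div_le_div_of_nonneg_left (sq_nonneg _) (by positivity)
      rw [sq]; exact mul_le_mul hpa hqa ha.le hp.le
    linarith
  have h3 : y - u = (p - q) + (min y a - min u a) := by
    linarith [max_add_min y a, max_add_min u a]
  have h4 : smoothLog a y - smoothLog a u
      = (Real.log p - Real.log q) + (min y a - min u a) / a := by
    simp only [smoothLog, hpd, hqd]; ring
  rw [h4]
  set d := min y a - min u a with hd
  -- The logarithmic part has used `(p - q) ^ 2` out of `(y - u) ^ 2`. The rest is left for the
  -- linear part, and its cross term helps because `p - q` and `d` have the same sign.
  have h5 : d / q - (2 * (p - q) * d + d ^ 2) / a ^ 2 ≤ d / a := by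
    rcases le_total u a with h | h
    · have hqe : q = a := max_eq_right h
      have h6 : 0 ≤ (p - q) * d := by
        rcases le_total y a with hy | hy
        · have : p = a := max_eq_right hy
          rw [this, hqe]; simp
        · have : 0 ≤ d := by
            rw [hd, min_eq_right hy, min_eq_left h]; linarith
          have : 0 ≤ p - q := by rw [hqe]; linarith
          positivity
      have h7 : 0 ≤ (2 * (p - q) * d + d ^ 2) / a ^ 2 := by
        apply div_nonneg _ (by positivity)
        nlinarith [sq_nonneg d]
      rw [hqe] at h7 ⊢
      linarith
    · have hqe : q = u := max_eq_left h
      have hd0 : d ≤ 0 := by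
        rw [hd, min_eq_right h]; exact sub_nonpos.2 (min_le_right _ _)
      rcases le_total y a with hy | hy
      · have hpe : p = a := max_eq_right hy
        rw [hpe]
        have h8 : d / q - d / a = d * (a - q) / (q * a) := by field_simp
        have h9 : d * (a - q) / (q * a) ≤ d * (a - q) / a ^ 2 := by
          apply div_le_div_of_nonneg_left (mul_nonneg_of_nonpos_of_nonpos hd0 (by linarith))
            (by positivity)
          nlinarith
        have h10 : d * (a - q) / a ^ 2 ≤ (2 * (a - q) * d + d ^ 2) / a ^ 2 := by
          apply div_le_div_of_nonneg_right _ (by positivity)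
          nlinarith [sq_nonneg d, mul_nonneg_of_nonpos_of_nonpos hd0 (by linarith : a - q ≤ 0)]
        linarith
      · have : d = 0 := by rw [hd, min_eq_right h, min_eq_right hy]; simp
        rw [this]; simp
  have h6 : (y - u) ^ 2 / a ^ 2
      = (p - q) ^ 2 / a ^ 2 + (2 * (p - q) * d + d ^ 2) / a ^ 2 := by
    rw [h3]; ring
  rw [h6, h3, add_div]
  linarith

theorem smoothLog_le_tangent {a c u : ℝ} (ha : 0 < a) (hc : a ≤ c) :
    smoothLog a u ≤ Real.log c + (u - c) / c := by
  have := smoothLog_sub_le ha c u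
  rw [max_eq_left hc, smoothLog_of_le hc] at this
  linarith

/-- Between `c` and `a ≤ c / 2` the logarithm bends away from its tangent by at least `log 2 - 1 / 2
> 1 / 6`, and below `a` the gap only grows. This strict gain later detects agents that are served
too little. -/
theorem smoothLog_le_tangent_sub {a c u : ℝ} (ha : 0 < a) (hc : 2 * a ≤ c) (hu : u < a) :
    smoothLog a u ≤ Real.log c + (u - c) / c - 1 / 6 := by
  have hc0 : 0 < c := by linarith
  have h1 : smoothLog a u = Real.log a + (u - a) / a := by
    simp [smoothLog, max_eq_right hu.le, min_eq_left hu.le]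
  have h2 : (u - a) / a ≤ (u - a) / c := by
    rw [div_eq_mul_inv, div_eq_mul_inv]
    exact mul_le_mul_of_nonpos_left (inv_anti₀ ha (by linarith)) (by linarith)
  have h3 : Real.log a ≤ Real.log c - Real.log 2 + 2 * a / c - 1 := by
    have := Real.log_le_sub_one_of_pos (show 0 < 2 * a / c by positivity)
    rw [Real.log_div (by positivity) hc0.ne', Real.log_mul (by norm_num) ha.ne'] at this
    linarith
  have h4 : a / c ≤ 1 / 2 := by
    rw [div_le_div_iff₀ hc0 (by norm_num)]; linarith
  have h5 : (u - c) / c = (u - a) / c + a / c - 1 := by field_simp; ring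
  have h6 : 2 * a / c = 2 * (a / c) := by ring
  have := Real.log_two_gt_d9
  rw [h1, h5]
  linarith

/-! ### The multipliers and the virtual utilities of dual averaging -/

/-- The lower end of the projection interval is never active, because `u ≤ h`. The upper end amounts
to a floor on `u`, so the multiplier is `b` times the derivative of `smoothLog` with `a = b * l / (1
+ δ₀)`. -/
theorem multiplier_eq {l h δ₀ b u : ℝ} (hl : 0 < l) (hlh : l ≤ h) (hδ : 0 < δ₀) (hb : 0 < b)
    (hb1 : b ≤ 1) (hu0 : 0 ≤ u) (huh : u ≤ h) :
    multiplier l h δ₀ b u = b / max u (b * l / (1 + δ₀)) := by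
  have hh : 0 < h := by linarith
  have hcap : b / (b * l / (1 + δ₀)) = (1 + δ₀) / l := by field_simp
  unfold multiplier
  split_ifs with h0
  · rw [h0, max_eq_right (by positivity), hcap]
  · have hu : 0 < u := lt_of_le_of_ne hu0 (Ne.symm h0)
    have h1 : b / (h * (1 + δ₀)) ≤ b / u := by
      apply div_le_div_of_nonneg_left hb.le hu; nlinarith
    have h2 : b / (h * (1 + δ₀)) ≤ (1 + δ₀) / l := by
      rw [div_le_div_iff₀ (by positivity) hl]
      nlinarith [mul_pos hh hδ, mul_pos hδ (mul_pos hh hδ)]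
    rw [max_eq_right (le_min h2 h1), ← hcap]
    rcases le_total u (b * l / (1 + δ₀)) with h | h
    · rw [max_eq_right h, min_eq_left]
      exact div_le_div_of_nonneg_left hb.le hu h
    · rw [max_eq_left h, min_eq_right]
      exact div_le_div_of_nonneg_left hb.le (by positivity) h

theorem daMean_mem_Icc {vhat : Fin n → Fin m → ℝ} {h : ℝ} (hv : ∀ i j, vhat i j ∈ Set.Icc 0 h)
    (hh : 0 ≤ h) (item : ℕ → Fin m) (win : ℕ → Fin n) (k : ℕ) (i : Fin n) :
    daMean vhat item win k i ∈ Set.Icc 0 h := by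
  induction k with
  | zero => simpa [daMean] using hh
  | succ k ih =>
    have h1 : (if win k = i then vhat i (item k) else 0) ∈ Set.Icc 0 h := by
      split_ifs
      · exact hv _ _
      · exact ⟨le_rfl, hh⟩
    have := (convex_Icc (0 : ℝ) h) ih h1 (a := (k : ℝ) / (k + 1)) (b := 1 / (k + 1))
      (by positivity) (by positivity) (by field_simp)
    simpa [daMean] using this

theorem mul_daMean (vhat : Fin n → Fin m → ℝ) (item : ℕ → Fin m) (win : ℕ → Fin n) (k : ℕ)
    (i : Fin n) : (k : ℝ) * daMean vhat item win k i
      = ∑ r ∈ Finset.range k, if win r = i then vhat i (item r) else 0 := by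
  induction k with
  | zero => simp
  | succ k ih =>
    rw [Finset.sum_range_succ, ← ih, daMean]
    push_cast
    field_simp

/-- Each round serves a single agent, so the total has the same bound as one value, without a factor
`n`. -/
theorem sum_daMean_le {vhat : Fin n → Fin m → ℝ} {h : ℝ} (hv : ∀ i j, vhat i j ∈ Set.Icc 0 h)
    (hh : 0 ≤ h) (item : ℕ → Fin m) (win : ℕ → Fin n) (k : ℕ) :
    ∑ i, daMean vhat item win k i ≤ h := by
  rcases Nat.eq_zero_or_pos k with rfl | hk
  · simpa [daMean] using hh
  · have hk' : (0 : ℝ) < k := by exact_mod_cast hk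
    refine le_of_mul_le_mul_left ?_ hk'
    rw [Finset.mul_sum]
    simp_rw [mul_daMean]
    rw [Finset.sum_comm]
    simp only [Finset.sum_ite_eq, Finset.mem_univ, if_true]
    calc _ ≤ ∑ r ∈ Finset.range k, h := Finset.sum_le_sum fun r _ => (hv _ _).2
      _ = k * h := by simp

/-- One step of dual averaging, seen as a step of the Frank-Wolfe method for the potential
`∑ i, smoothLog a (u i)`. -/
theorem potential_step {vhat : Fin n → Fin m → ℝ} {h a : ℝ}
    (hv : ∀ i j, vhat i j ∈ Set.Icc 0 h) (hh : 0 ≤ h) (ha : 0 < a) (item : ℕ → Fin m)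
    (win : ℕ → Fin n) (k : ℕ) (y : Fin n → ℝ) :
    (k : ℝ) * (∑ i, smoothLog a (daMean vhat item win k i)) + ∑ i, smoothLog a (y i)
        + (vhat (win k) (item k) / max (daMean vhat item win k (win k)) a
            - ∑ i, y i / max (daMean vhat item win k i) a)
        - n * (h / a) ^ 2 * (1 / ((k : ℝ) + 1))
      ≤ ((k + 1 : ℕ) : ℝ) * ∑ i, smoothLog a (daMean vhat item win (k + 1) i) := by
  set u := daMean vhat item win k with hu
  set x : Fin n → ℝ := fun i => if win k = i then vhat i (item k) else 0 with hx
  have hk : (0 : ℝ) < (k : ℝ) + 1 := by positivity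
  have hxm : ∀ i, x i ∈ Set.Icc 0 h := by
    intro i
    simp only [hx]
    split_ifs
    · exact hv _ _
    · exact ⟨le_rfl, hh⟩
  have hum : ∀ i, u i ∈ Set.Icc 0 h := fun i => daMean_mem_Icc hv hh item win k i
  have hsucc : ∀ i, daMean vhat item win (k + 1) i - u i = (x i - u i) / (k + 1) := by
    intro i
    simp only [daMean, ← hu, hx]
    field_simp
    ring
  have hone : ∀ i, (k : ℝ) * smoothLog a (u i) + smoothLog a (y i)
      + (x i / max (u i) a - y i / max (u i) a) - (h / a) ^ 2 * (1 / ((k : ℝ) + 1))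
      ≤ ((k : ℝ) + 1) * smoothLog a (daMean vhat item win (k + 1) i) := by
    intro i
    have h1 := le_smoothLog_sub ha (u i) (daMean vhat item win (k + 1) i)
    rw [hsucc] at h1
    -- Writing `x - u = (x - y) + (y - u)` in the linearized gain, concavity exchanges the second
    -- part for the difference of potentials at `y` and `u`.
    have h2 := smoothLog_sub_le ha (u i) (y i)
    have h3 : (x i - u i) ^ 2 ≤ h ^ 2 := by
      rw [sq_le_sq, abs_of_nonneg hh, abs_le]
      constructor <;> linarith [(hxm i).1, (hxm i).2, (hum i).1, (hum i).2]
    have h4 : ((k : ℝ) + 1) * (((x i - u i) / (k + 1)) / max (u i) a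
        - ((x i - u i) / (k + 1)) ^ 2 / a ^ 2)
        = (x i - u i) / max (u i) a - (x i - u i) ^ 2 / a ^ 2 * (1 / ((k : ℝ) + 1)) := by
      have : max (u i) a ≠ 0 := (lt_max_of_lt_right ha).ne'
      field_simp
    have h5 : (x i - u i) ^ 2 / a ^ 2 * (1 / ((k : ℝ) + 1))
        ≤ (h / a) ^ 2 * (1 / ((k : ℝ) + 1)) := by
      rw [div_pow]; gcongr
    have h6 := mul_le_mul_of_nonneg_left h1 hk.le
    rw [h4] at h6
    rw [sub_div] at h2 h6
    linarith
  have hsum := Finset.sum_le_sum fun i (_ : i ∈ Finset.univ) => hone i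
  rw [Finset.sum_sub_distrib, Finset.sum_add_distrib, Finset.sum_add_distrib, ← Finset.mul_sum,
    Finset.sum_sub_distrib, ← Finset.mul_sum, Finset.sum_const, Finset.card_univ,
    Fintype.card_fin, nsmul_eq_mul] at hsum
  have hxs : ∑ i, x i / max (u i) a = vhat (win k) (item k) / max (u (win k)) a := by
    rw [Finset.sum_eq_single (win k)]
    · simp [hx]
    · intro i _ hi
      simp [hx, Ne.symm hi]
    · simp
  rw [hxs, ← Finset.mul_sum] at hsum
  push_cast
  linarith

/-- The potential of dual averaging on a good path: `x` is an arbitrary fractional allocation for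
the values `v`, of which `vhat` is an approximation, and `u` are utilities compared with it. -/
theorem potential_lower_bound {v vhat : Fin n → Fin m → ℝ} {h a η : ℝ}
    (hv : ∀ i j, vhat i j ∈ Set.Icc 0 h) (hh : 0 ≤ h) (ha : 0 < a)
    (hη : ∀ i j, (1 - η) * v i j ≤ vhat i j) {x : Fin n → Fin m → ℝ} (hx : Feasible x)
    {u : Fin n → ℝ} (hu : ∀ i, a ≤ (1 - η) * u i) (item : ℕ → Fin m) (win : ℕ → Fin n) (R : ℕ)
    (hbid : ∀ r < R, ∀ k, vhat k (item r) / max (daMean vhat item win r k) a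
      ≤ vhat (win r) (item r) / max (daMean vhat item win r (win r)) a) :
    R * (∑ i, Real.log ((1 - η) * u i))
        + (1 - η) * ∑ r ∈ Finset.range R, ∑ i,
            (max (daMean vhat item win r i) a)⁻¹ * (v i (item r) * x i (item r) - u i)
        - n * (h / a) ^ 2 * ∑ r ∈ Finset.range R, 1 / ((r : ℝ) + 1)
      ≤ R * ∑ i, smoothLog a (daMean vhat item win R i) := by
  induction R with
  | zero => simp
  | succ R ih =>
    have ih := ih fun r hr => hbid r (by omega)
    have hstep := potential_step hv hh ha item win R (fun i => (1 - η) * u i)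
    refine le_trans ?_ hstep
    simp_rw [fun i => smoothLog_of_le (hu i)]
    rw [Finset.sum_range_succ, Finset.sum_range_succ]
    -- The winning bid is at least every bid, hence at least their average with the weights `x i
    -- (item R)`, whose sum is at most `1`. Splitting the item fractionally would not have done
    -- better.
    have hkey : (1 - η) * ∑ i, (max (daMean vhat item win R i) a)⁻¹
          * (v i (item R) * x i (item R) - u i)
        ≤ vhat (win R) (item R) / max (daMean vhat item win R (win R)) a
          - ∑ i, (1 - η) * u i / max (daMean vhat item win R i) a := by
      set w := vhat (win R) (item R) / max (daMean vhat item win R (win R)) a with hw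
      have hw0 : 0 ≤ w := div_nonneg (hv _ _).1 (lt_max_of_lt_right ha).le
      have h1 : ∑ i, x i (item R) * w ≤ w := by
        rw [← Finset.sum_mul]
        exact mul_le_of_le_one_left hw0 (hx.1 _)
      have h2 : ∀ i, (1 - η) * ((max (daMean vhat item win R i) a)⁻¹
          * (v i (item R) * x i (item R) - u i))
          ≤ x i (item R) * w - (1 - η) * u i / max (daMean vhat item win R i) a := by
        intro i
        have hm : 0 < max (daMean vhat item win R i) a := lt_max_of_lt_right ha
        have h3 := mul_le_mul_of_nonneg_left (hbid R (by omega) i) (hx.2 i (item R))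
        have h4 : x i (item R) * ((1 - η) * v i (item R) / max (daMean vhat item win R i) a)
            ≤ x i (item R) * (vhat i (item R) / max (daMean vhat item win R i) a) := by
          gcongr
          · exact hx.2 _ _
          · exact hη _ _
        have h5 : (1 - η) * ((max (daMean vhat item win R i) a)⁻¹
          * (v i (item R) * x i (item R) - u i))
          = x i (item R) * ((1 - η) * v i (item R) / max (daMean vhat item win R i) a)
            - (1 - η) * u i / max (daMean vhat item win R i) a := by
          field_simp
        linarith
      rw [Finset.mul_sum]
      refine (Finset.sum_le_sum fun i _ => h2 i).trans ?_
      rw [Finset.sum_sub_distrib]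
      linarith
    push_cast
    linarith

/-! ### The Eisenberg-Gale program -/

theorem isCompact_feasible : IsCompact {x : Fin n → Fin m → ℝ | Feasible x} := by
  refine (isCompact_Icc (a := (0 : Fin n → Fin m → ℝ)) (b := 1)).of_isClosed_subset ?_ ?_
  · have : {x : Fin n → Fin m → ℝ | Feasible x}
        = (⋂ j, {x | ∑ i, x i j ≤ 1}) ∩ ⋂ i, ⋂ j, {x | 0 ≤ x i j} := by
      ext x; simp [Feasible]
    rw [this]
    refine IsClosed.inter (isClosed_iInter fun j => isClosed_le (by fun_prop) (by fun_prop))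
      (isClosed_iInter fun i => isClosed_iInter fun j => isClosed_le (by fun_prop) (by fun_prop))
  · intro x hx
    refine ⟨fun i j => hx.2 i j, fun i j => ?_⟩
    exact (Finset.single_le_sum (fun k _ => hx.2 k j) (Finset.mem_univ i)).trans (hx.1 j)

/-- First-order optimality: if the ratios `r i` cannot be improved along the segment from `1` to
`r`, then their sum is at most `n`. -/
theorem sum_le_of_prod_segment_le {r : Fin n → ℝ} (hr : ∀ i, 0 ≤ r i)
    (hopt : ∀ θ ∈ Set.Icc (0 : ℝ) 1, ∏ i, (1 + θ * (r i - 1)) ≤ 1) :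
    ∑ i, (r i - 1) ≤ 0 := by
  by_contra hcon
  push Not at hcon
  set S := ∑ i, (r i - 1) with hS
  set Q := ∑ i, (r i - 1) ^ 2 with hQ
  have hQ0 : 0 ≤ Q := Finset.sum_nonneg fun i _ => sq_nonneg _
  -- Small enough for the first-order gain `θ * S` to beat the second-order loss `2 * θ ^ 2 * Q`;
  -- the bound `1 / 2` keeps all factors positive.
  set θ := min (1 / 2) (S / (2 * (Q + 1))) with hθ
  have hθ0 : 0 < θ := lt_min (by norm_num) (by positivity)
  have hθ1 : θ ≤ 1 / 2 := min_le_left _ _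
  have hθ2 : θ * (2 * (Q + 1)) ≤ S := by
    have : θ ≤ S / (2 * (Q + 1)) := min_le_right _ _
    rwa [le_div_iff₀ (by positivity)] at this
  have hlow : ∀ i, -(1 / 2) ≤ θ * (r i - 1) := fun i => by nlinarith [hr i]
  have hlog : ∀ i, θ * (r i - 1) - 2 * (θ * (r i - 1)) ^ 2 ≤ Real.log (1 + θ * (r i - 1)) := by
    intro i
    have h1 := hlow i
    set z := θ * (r i - 1)
    have h2 := Real.one_sub_inv_le_log_of_pos (show 0 < 1 + z by linarith)
    refine le_trans ?_ h2
    have h3 : 1 - (1 + z)⁻¹ = z / (1 + z) := by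
      have : (1 + z) ≠ 0 := by linarith
      field_simp; ring
    rw [h3, le_div_iff₀ (by linarith)]
    nlinarith [mul_nonneg (sq_nonneg z) (by linarith : (0:ℝ) ≤ 1 + 2 * z)]
  have h1 : ∑ i, Real.log (1 + θ * (r i - 1)) ≤ 0 := by
    rw [← Real.log_prod (fun i _ => by linarith [hlow i])]
    exact Real.log_nonpos (Finset.prod_nonneg fun i _ => by linarith [hlow i])
      (hopt θ ⟨hθ0.le, by linarith⟩)
  have h2 := (Finset.sum_le_sum fun i (_ : i ∈ Finset.univ) => hlog i).trans h1
  rw [Finset.sum_sub_distrib, ← Finset.mul_sum] at h2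
  have h3 : ∑ i, 2 * (θ * (r i - 1)) ^ 2 = 2 * θ ^ 2 * Q := by
    rw [hQ, Finset.mul_sum]; exact Finset.sum_congr rfl fun i _ => by ring
  rw [h3, ← hS] at h2
  nlinarith [mul_le_mul_of_nonneg_left hθ2 hθ0.le]

theorem geomMean_le {u : Fin n → ℝ} (hn : 0 < n) (hu : ∀ i, 0 ≤ u i) :
    ∏ i, (u i) ^ (1 / n : ℝ) ≤ (∑ i, u i) / n := by
  have hn' : (0 : ℝ) < n := by exact_mod_cast hn
  have := Real.geom_mean_le_arith_mean_weighted Finset.univ (fun _ => (1 / n : ℝ)) u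
    (fun _ _ => by positivity) (by simp [hn'.ne']) (fun i _ => hu i)
  rw [← Finset.mul_sum] at this
  linarith [this, one_div_mul_eq_div (n : ℝ) (∑ i, u i)]

theorem prod_rpow_mul {u : Fin n → ℝ} {c : ℝ} (hn : 0 < n) (hc : 0 ≤ c) (hu : ∀ i, 0 ≤ u i) :
    ∏ i, (c * u i) ^ (1 / n : ℝ) = c * ∏ i, (u i) ^ (1 / n : ℝ) := by
  simp_rw [fun i => Real.mul_rpow (z := (1 / n : ℝ)) hc (hu i)]
  rw [Finset.prod_mul_distrib, Finset.prod_const, Finset.card_univ, Fintype.card_fin, one_div,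
    Real.rpow_inv_natCast_pow hc (Nat.pos_iff_ne_zero.1 hn)]

/-- An optimal allocation of the Eisenberg-Gale program with equal weights and uniformly distributed
types, together with equilibrium prices. -/
theorem exists_equilibrium {v : Fin n → Fin m → ℝ} {c d : ℝ} (hn : 0 < n) (hm : 0 < m)
    (hc : 0 < c) (hv : ∀ i j, c ≤ v i j ∧ v i j ≤ d) :
    ∃ (x : Fin n → Fin m → ℝ) (u : Fin n → ℝ) (p : Fin m → ℝ), Feasible x ∧
      (∀ i, u i = ∑ j, 1 / m * (v i j * x i j)) ∧ (∀ i, c / n ≤ u i) ∧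
      ONSW (fun _ => 1 / n) (fun _ => 1 / m) v = ∏ i, (u i) ^ (1 / n : ℝ) ∧
      ∏ i, (u i) ^ (1 / n : ℝ) ≤ d / n ∧
      (∀ i j, v i j / (n * u i) ≤ p j) ∧ ∑ j, 1 / m * p j ≤ 1 := by
  have hn' : (0 : ℝ) < n := by exact_mod_cast hn
  have hm' : (0 : ℝ) < m := by exact_mod_cast hm
  have : Nonempty (Fin n) := ⟨⟨0, hn⟩⟩
  have : Nonempty (Fin m) := ⟨⟨0, hm⟩⟩
  set W : (Fin n → Fin m → ℝ) → Fin n → ℝ := fun x i => ∑ j, 1 / m * v i j * x i j with hW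
  set F : (Fin n → Fin m → ℝ) → ℝ := fun x => ∏ i, (W x i) ^ (1 / n : ℝ) with hF
  have hvpos : ∀ i j, 0 < v i j := fun i j => hc.trans_le (hv i j).1
  have hWnn : ∀ x, Feasible x → ∀ i, 0 ≤ W x i := fun x hx i =>
    Finset.sum_nonneg fun j _ => mul_nonneg (mul_nonneg (by positivity) (hvpos i j).le) (hx.2 i j)
  have hunif : Feasible (fun (_ : Fin n) (_ : Fin m) => (1 / n : ℝ)) :=
    ⟨fun j => by simp [hn'.ne'], fun i j => by positivity⟩
  have hFcont : Continuous F := by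
    refine continuous_finsetProd _ fun i _ => ?_
    refine Continuous.rpow_const (by simp only [hW]; fun_prop) fun x => Or.inr (by positivity)
  obtain ⟨x, hx, hmax⟩ := isCompact_feasible.exists_isMaxOn ⟨_, hunif⟩ hFcont.continuousOn
  have hmax' : ∀ y, Feasible y → F y ≤ F x := fun y hy => hmax hy
  have hFpos : 0 < F x := by
    refine lt_of_lt_of_le ?_ (hmax' _ hunif)
    refine Finset.prod_pos fun i _ => Real.rpow_pos_of_pos (Finset.sum_pos (fun j _ => ?_) (by simp)) _
    have := hvpos i j
    positivity
  have hupos : ∀ i, 0 < W x i := by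
    intro i
    refine lt_of_le_of_ne (hWnn x hx i) fun h0 => ?_
    have : F x = 0 := Finset.prod_eq_zero (Finset.mem_univ i) (by
      rw [← h0]; exact Real.zero_rpow (by positivity))
    exact hFpos.ne' this
  -- Proportional fairness, the first-order condition at the maximizer: moving towards any feasible
  -- `y` multiplies the objective by a factor of at most `1`.
  have hfair : ∀ y, Feasible y → ∑ i, W y i / (n * W x i) ≤ 1 := by
    intro y hy
    have hr : ∀ i, 0 ≤ W y i / W x i := fun i => div_nonneg (hWnn y hy i) (hupos i).le
    have h1 := sum_le_of_prod_segment_le hr (by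
      rintro θ ⟨hθ0, hθ1⟩
      have hz : Feasible (fun i j => (1 - θ) * x i j + θ * y i j) := by
        refine ⟨fun j => ?_, fun i j => ?_⟩
        · rw [Finset.sum_add_distrib, ← Finset.mul_sum, ← Finset.mul_sum]
          nlinarith [hx.1 j, hy.1 j]
        · exact add_nonneg (mul_nonneg (by linarith) (hx.2 i j)) (mul_nonneg hθ0 (hy.2 i j))
      have hWz : ∀ i, W (fun i j => (1 - θ) * x i j + θ * y i j) i
          = W x i * (1 + θ * (W y i / W x i - 1)) := by
        intro i
        have e1 : W (fun i j => (1 - θ) * x i j + θ * y i j) i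
            = (1 - θ) * W x i + θ * W y i := by
          simp only [hW, Finset.mul_sum, ← Finset.sum_add_distrib]
          exact Finset.sum_congr rfl fun j _ => by ring
        rw [e1]
        have := (hupos i).ne'
        field_simp
        ring
      have hfac : ∀ i, 0 ≤ 1 + θ * (W y i / W x i - 1) := fun i => by
        nlinarith [hr i, mul_nonneg hθ0 (hr i)]
      have h2 := hmax' _ hz
      simp only [hF] at h2
      simp_rw [hWz] at h2
      simp_rw [fun i => Real.mul_rpow (z := (1 / n : ℝ)) (hupos i).le (hfac i)] at h2
      rw [Finset.prod_mul_distrib] at h2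
      have h3 : ∏ i, (1 + θ * (W y i / W x i - 1)) ^ (1 / n : ℝ) ≤ 1 := by
        by_contra hcon
        push Not at hcon
        exact absurd h2 (not_le.2 (lt_mul_of_one_lt_right hFpos hcon))
      rw [Real.finsetProd_rpow _ _ (fun i _ => hfac i)] at h3
      by_contra hcon
      push Not at hcon
      exact absurd h3 (not_le.2 (Real.one_lt_rpow hcon (by positivity))))
    rw [Finset.sum_sub_distrib] at h1
    simp only [Finset.sum_const, Finset.card_univ, Fintype.card_fin, nsmul_eq_mul, mul_one] at h1
    have h2 : ∑ i, W y i / (n * W x i) = (∑ i, W y i / W x i) / n := by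
      rw [Finset.sum_div]; exact Finset.sum_congr rfl fun i _ => by
        rw [div_div, mul_comm]
    rw [h2, div_le_one hn']
    linarith
  have hargmax : ∀ j, ∃ k, ∀ i, v i j / (n * W x i) ≤ v k j / (n * W x k) := fun j =>
    Finite.exists_max fun i => v i j / (n * W x i)
  choose k hk using hargmax
  -- The price of a type is its largest value per unit of weighted utility. Fairness, applied to the
  -- allocation that gives each type entirely to a maximizing agent, bounds the mean price.
  have hprice : ∑ j, 1 / m * (v (k j) j / (n * W x (k j))) ≤ 1 := by
    have hy : Feasible (fun i j => if i = k j then (1 : ℝ) else 0) :=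
      ⟨fun j => by simp, fun i j => by dsimp only; split_ifs <;> norm_num⟩
    refine le_of_eq_of_le ?_ (hfair _ hy)
    simp only [hW, Finset.sum_div]
    rw [Finset.sum_comm]
    refine Finset.sum_congr rfl fun j _ => ?_
    rw [Finset.sum_eq_single (k j)]
    · simp only [if_true, mul_one]
      ring
    · intro i _ hi
      simp [hi]
    · simp
  refine ⟨x, W x, fun j => v (k j) j / (n * W x (k j)), hx, fun i => ?_, fun i => ?_, ?_, ?_,
    fun i j => hk j i, hprice⟩
  · exact Finset.sum_congr rfl fun j _ => by ring
  -- Every price is at least `c / (n * W x i)`, while the mean price is at most `1`.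
  · have h1 : c / (n * W x i) ≤ 1 := by
      refine le_trans ?_ hprice
      calc c / (n * W x i) = ∑ j : Fin m, 1 / m * (c / (n * W x i)) := by
            simp only [Finset.sum_const, Finset.card_univ, Fintype.card_fin, nsmul_eq_mul]
            field_simp
        _ ≤ _ := by
            refine Finset.sum_le_sum fun j _ => mul_le_mul_of_nonneg_left ?_ (by positivity)
            refine le_trans ?_ (hk j i)
            have := hupos i
            gcongr
            exact (hv i j).1
    rw [div_le_one (mul_pos hn' (hupos i))] at h1
    rw [div_le_iff₀ hn']
    linarith
  · refine IsGreatest.csSup_eq ⟨⟨x, hx, rfl⟩, ?_⟩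
    rintro r ⟨y, hy, rfl⟩
    exact hmax' y hy
  · refine (geomMean_le hn fun i => (hupos i).le).trans ?_
    gcongr
    simp only [hW]
    rw [Finset.sum_comm]
    have hd : 0 ≤ d := (hvpos ⟨0, hn⟩ ⟨0, hm⟩).le.trans (hv _ _).2
    calc _ ≤ ∑ j : Fin m, 1 / m * d := by
          refine Finset.sum_le_sum fun j _ => ?_
          calc _ ≤ ∑ i, 1 / m * d * x i j := Finset.sum_le_sum fun i _ => by
                have := hx.2 i j
                gcongr
                exact (hv i j).2
            _ = 1 / m * d * ∑ i, x i j := by rw [Finset.mul_sum]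
            _ ≤ 1 / m * d := mul_le_of_le_one_right (by positivity) (hx.1 j)
      _ = d := by
          simp only [Finset.sum_const, Finset.card_univ, Fintype.card_fin, nsmul_eq_mul]
          field_simp

/-! ### From the potential to the Nash social welfare -/

theorem geomMean_eq_exp {u : Fin n → ℝ} (hu : ∀ i, 0 < u i) :
    ∏ i, (u i) ^ (1 / n : ℝ) = Real.exp ((∑ i, Real.log (u i)) / n) := by
  rw [Finset.sum_div, Real.exp_sum]
  refine Finset.prod_congr rfl fun i _ => ?_
  rw [Real.rpow_def_of_pos (hu i), mul_one_div]

/-- The inequality `1 + x ≤ exp x` turns the logarithmic gap into a welfare gap. As every `u i` is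
at least `a`, the noise shrinks each coordinate by at most the common factor `1 - S`, which leaves
the geometric mean by homogeneity; for `S ≥ 1` the bound is trivial. Hence noise enters only through
the sum of its absolute values. -/
theorem sub_geomMean_le {u N U : Fin n → ℝ} {R a η h w : ℝ} (hn : 0 < n) (hR : 0 < R) (ha : 0 < a)
    (hw : 0 < w) (hu : ∀ i, a ≤ u i) (hsum : ∑ i, u i ≤ h) (hη0 : 0 ≤ η) (hη : η ≤ 1 / 2)
    (hU : ∀ i, (1 - η) * (R * u i) - |N i| ≤ U i) :
    R * w - ∏ i, (max (U i) 0) ^ (1 / n : ℝ)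
      ≤ R * w * (Real.log w - (∑ i, Real.log (u i)) / n) + R * η * (h / n)
        + h / n * (2 / a) * ∑ i, |N i| := by
  have hn' : (0 : ℝ) < n := by exact_mod_cast hn
  have hupos : ∀ i, 0 < u i := fun i => ha.trans_le (hu i)
  set E := ∏ i, (u i) ^ (1 / n : ℝ) with hE
  have hE0 : 0 ≤ E := Finset.prod_nonneg fun i _ => Real.rpow_nonneg (hupos i).le _
  have hEh : E ≤ h / n := (geomMean_le hn fun i => (hupos i).le).trans (by gcongr)
  have hgap : w - E ≤ w * (Real.log w - (∑ i, Real.log (u i)) / n) := by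
    rw [hE, geomMean_eq_exp hupos]
    set g := (∑ i, Real.log (u i)) / n
    have h1 : Real.exp g = w * Real.exp (g - Real.log w) := by
      rw [Real.exp_sub, Real.exp_log hw]; field_simp
    have h2 := Real.add_one_le_exp (g - Real.log w)
    rw [h1]
    nlinarith
  set S := (∑ i, |N i|) * (2 / (R * a)) with hS
  have hS0 : 0 ≤ S := mul_nonneg (Finset.sum_nonneg fun i _ => abs_nonneg _) (by positivity)
  have hprod : (1 - η) * R * (1 - S) * E ≤ ∏ i, (max (U i) 0) ^ (1 / n : ℝ) := by
    rcases le_total 1 S with hS1 | hS1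
    · refine le_trans ?_ (Finset.prod_nonneg fun i _ => Real.rpow_nonneg (le_max_right _ _) _)
      have : 0 ≤ (1 - η) * R * E := mul_nonneg (mul_nonneg (by linarith) hR.le) hE0
      nlinarith
    · have hc : 0 ≤ (1 - η) * R * (1 - S) :=
        mul_nonneg (mul_nonneg (by linarith) hR.le) (by linarith)
      rw [hE, ← prod_rpow_mul hn hc fun i => (hupos i).le]
      refine Finset.prod_le_prod (fun i _ => Real.rpow_nonneg (mul_nonneg hc (hupos i).le) _)
        fun i _ => ?_
      refine Real.rpow_le_rpow (mul_nonneg hc (hupos i).le) ?_ (by positivity)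
      refine le_trans ?_ (le_max_left _ _)
      refine le_trans ?_ (hU i)
      have h1 : |N i| * (2 / (R * a)) ≤ S := by
        refine mul_le_mul_of_nonneg_right ?_ (by positivity)
        exact Finset.single_le_sum (f := fun i => |N i|) (fun k _ => abs_nonneg _)
          (Finset.mem_univ i)
      have h2 : R * a / 2 ≤ (1 - η) * (R * u i) := by
        have : R * a ≤ R * u i := by gcongr; exact hu i
        nlinarith [mul_pos hR ha]
      have h3 : |N i| ≤ (1 - η) * (R * u i) * S := by
        calc |N i| = R * a / 2 * (|N i| * (2 / (R * a))) := by field_simp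
          _ ≤ R * a / 2 * S := by gcongr
          _ ≤ _ := by gcongr
      linarith
  have h4 : (1 - η) * R * (1 - S) * E = R * E - R * η * E - (1 - η) * R * S * E := by ring
  have h5 : R * η * E ≤ R * η * (h / n) := by gcongr
  have h6 : (1 - η) * R * S * E ≤ h / n * (2 / a) * ∑ i, |N i| := by
    have e : R * S = 2 / a * ∑ i, |N i| := by rw [hS]; field_simp
    have h7 : (1 - η) * (R * S * E) ≤ R * S * E :=
      mul_le_of_le_one_left (by positivity) (by linarith)
    have h8 : R * S * E ≤ R * S * (h / n) := by gcongr
    rw [e] at h8 h7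
    calc _ = (1 - η) * (R * S * E) := by ring
      _ ≤ _ := by rw [e]; linarith
  have h9 := mul_le_mul_of_nonneg_left hgap hR.le
  linarith

/-! ### Independence and measurability -/

theorem integral_mul_comp_of_indep {Ω : Type*} {m' mΩ : MeasurableSpace Ω} {P : Measure Ω}
    [IsProbabilityMeasure P] {k : ℕ}
    {X : Ω → Fin k} {f : Ω → ℝ} (hm' : m' ≤ mΩ) (hX : Measurable X)
    (hind : Indep (MeasurableSpace.comap X ⊤) m' P) (hf : Measurable[m'] f) (q : Fin k → ℝ) :
    ∫ ω, f ω * q (X ω) ∂P = (∫ ω, f ω ∂P) * ∑ j, P.real (X ⁻¹' {j}) * q j := by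
  have hqX : Measurable (fun ω => q (X ω)) := (measurable_of_finite q).comp hX
  have h1 : IndepFun f (fun ω => q (X ω)) P := by
    rw [IndepFun_iff_Indep]
    refine indep_of_indep_of_le_left (indep_of_indep_of_le_right hind.symm ?_) hf.comap_le
    rintro s ⟨t, -, rfl⟩
    exact ⟨q ⁻¹' t, trivial, rfl⟩
  have h2 := h1.integral_fun_mul_eq_mul_integral (hf.mono hm' le_rfl).aestronglyMeasurable
    hqX.aestronglyMeasurable
  rw [h2]
  congr 1
  have h3 : ∫ ω, q (X ω) ∂P = ∫ j, q j ∂(P.map X) :=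
    (integral_map hX.aemeasurable (measurable_of_finite q).aestronglyMeasurable).symm
  have : IsProbabilityMeasure (P.map X) := Measure.isProbabilityMeasure_map hX.aemeasurable
  rw [h3, integral_fintype (.of_finite)]
  refine Finset.sum_congr rfl fun j _ => ?_
  rw [smul_eq_mul, measureReal_def, measureReal_def,
    Measure.map_apply hX (measurableSet_singleton j)]

theorem measurable_apply_fin {Ω : Type*} {m' : MeasurableSpace Ω} {X : Ω → Fin n} {Y : Ω → Fin m}
    {f : Fin n → Fin m → Ω → ℝ} (hX : Measurable X) (hY : Measurable Y)
    (hf : ∀ i j, Measurable (f i j)) : Measurable fun ω => f (X ω) (Y ω) ω := by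
  have h1 : Measurable fun p : (Fin n × Fin m) × Ω => f p.1.1 p.1.2 p.2 :=
    measurable_from_prod_countable_right fun x => hf x.1 x.2
  exact h1.comp ((hX.prodMk hY).prodMk measurable_id)

/-- A nonnegative weight known to `G` can be pulled out of the conditional expectation, where the
bound `C` applies. This is one step of a supermartingale argument. -/
theorem integral_mul_le_of_condExp_le {Ω : Type*} {G mΩ : MeasurableSpace Ω} {P : Measure Ω}
    [IsProbabilityMeasure P] {W E Z : Ω → ℝ} {C : ℝ} (hG : G ≤ mΩ) (hW : Measurable[G] W)
    (hW0 : ∀ ω, 0 ≤ W ω) (hWE : Integrable (W * E) P) (hE : Integrable E P) (hZ : Integrable Z P)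
    (hWZ : ∀ ω, W ω * C ≤ Z ω) (hC : P[E|G] ≤ᵐ[P] fun _ => C) :
    ∫ ω, (W * E) ω ∂P ≤ ∫ ω, Z ω ∂P := by
  rw [← integral_condExp hG]
  refine integral_mono_ae integrable_condExp hZ ?_
  filter_upwards [condExp_mul_of_stronglyMeasurable_left hW.stronglyMeasurable hWE hE, hC]
    with ω h2 h3
  rw [h2, Pi.mul_apply]
  exact (mul_le_mul_of_nonneg_left h3 (hW0 ω)).trans (hWZ ω)

/-- What is known when the noise of round `k` is drawn. -/
abbrev infoBeforeNoise {Ω : Type*} {mΩ : MeasurableSpace Ω} (H : Filtration ℕ mΩ)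
    (item : ℕ → Ω → Fin m) (win : ℕ → Ω → Fin n) (k : ℕ) : MeasurableSpace Ω :=
  H k ⊔ MeasurableSpace.comap (item k) ⊤ ⊔ MeasurableSpace.comap (win k) ⊤

namespace IsDAEtCRun

variable {l h δ₀ σ : ℝ} {B : Fin n → ℝ} {s : Fin m → ℝ} {v : Fin n → Fin m → ℝ} {T₀ T : ℕ}
  {Ω : Type*} {mΩ : MeasurableSpace Ω} {P : Measure Ω} {H : Filtration ℕ mΩ}
  {item : ℕ → Ω → Fin m} {win : ℕ → Ω → Fin n} {noise : ℕ → Ω → ℝ}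

theorem item_measurable_of_lt (hrun : IsDAEtCRun l h δ₀ σ B s v T₀ T P H item win noise) {t k : ℕ}
    (ht : t < T) (htk : t < k) : Measurable[H k] (item t) :=
  (hrun.item_measurable t ht).mono (H.mono htk) le_rfl

theorem win_measurable_of_lt (hrun : IsDAEtCRun l h δ₀ σ B s v T₀ T P H item win noise) {t k : ℕ}
    (ht : t < T) (htk : t < k) : Measurable[H k] (win t) :=
  (hrun.win_measurable t ht).mono (H.mono htk) le_rfl

theorem noise_measurable_of_lt (hrun : IsDAEtCRun l h δ₀ σ B s v T₀ T P H item win noise) {t k : ℕ}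
    (ht : t < T) (htk : t < k) : Measurable[H k] (noise t) :=
  (hrun.noise_measurable t ht).mono (H.mono htk) le_rfl

theorem measurable_sum (hrun : IsDAEtCRun l h δ₀ σ B s v T₀ T P H item win noise) {k : ℕ}
    (hk : k ≤ T) {f : Fin n → Fin m → ℝ → ℝ} (hf : ∀ i j, Measurable (f i j)) :
    Measurable[H k] fun ω => ∑ t ∈ Finset.range k, f (win t ω) (item t ω) (noise t ω) := by
  refine Finset.measurable_sum _ fun t ht => ?_
  rw [Finset.mem_range] at ht
  exact measurable_apply_fin (f := fun i j ω => f i j (noise t ω))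
    (hrun.win_measurable_of_lt (ht.trans_le hk) ht) (hrun.item_measurable_of_lt (ht.trans_le hk) ht)
    fun i j => (hf i j).comp (hrun.noise_measurable_of_lt (ht.trans_le hk) ht)

theorem measurable_count (hrun : IsDAEtCRun l h δ₀ σ B s v T₀ T P H item win noise) {k : ℕ}
    (hk : k ≤ T) (i : Fin n) (j : Fin m) :
    Measurable[H k] fun ω => (count (fun τ => item τ ω) (fun τ => win τ ω) k i j : ℝ) := by
  have h1 := hrun.measurable_sum hk (f := fun i' j' _ => if i' = i ∧ j' = j then 1 else 0)
    (fun i' j' => measurable_const)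
  convert h1 using 2 with ω
  rw [count, Finset.card_filter]
  push_cast
  rfl

theorem measurable_estimator (hrun : IsDAEtCRun l h δ₀ σ B s v T₀ T P H item win noise)
    (hT : T₀ ≤ T) (i : Fin n) (j : Fin m) :
    Measurable[H T₀] fun ω =>
      estimator v (fun τ => item τ ω) (fun τ => win τ ω) (fun τ => noise τ ω) T₀ i j := by
  unfold estimator
  refine Measurable.div ?_ (hrun.measurable_count hT i j)
  exact hrun.measurable_sum hT
    (f := fun i' j' x => if i' = i ∧ j' = j then v i' j' + x else 0)
    (fun i' j' => by split_ifs <;> fun_prop)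

/-- The mean utilities are known before the next type is drawn; this predictability makes the
comparison terms centered. -/
theorem measurable_daMean (hrun : IsDAEtCRun l h δ₀ σ B s v T₀ T P H item win noise)
    (hT : T₀ ≤ T) {r : ℕ} (hr : T₀ + r ≤ T) (i : Fin n) :
    Measurable[H (T₀ + r)] fun ω =>
      daMean (estimator v (fun τ => item τ ω) (fun τ => win τ ω) (fun τ => noise τ ω) T₀)
        (fun r => item (T₀ + r) ω) (fun r => win (T₀ + r) ω) r i := by
  induction r with
  | zero => simp only [daMean]; exact measurable_const
  | succ r ih =>
    simp only [daMean]
    have h1 := (ih (by omega)).mono (H.mono (show T₀ + r ≤ T₀ + (r + 1) by omega)) le_rfl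
    refine (h1.const_mul _).add (Measurable.const_mul ?_ _)
    refine measurable_apply_fin (f := fun i' j' ω => if i' = i then
        estimator v (fun τ => item τ ω) (fun τ => win τ ω) (fun τ => noise τ ω) T₀ i j' else 0)
      (hrun.win_measurable_of_lt (by omega) (by omega))
      (hrun.item_measurable_of_lt (by omega) (by omega)) fun i' j' => ?_
    by_cases hi : i' = i
    · simp only [hi, if_true]
      exact (hrun.measurable_estimator hT i j').mono (H.mono (by omega)) le_rfl
    · simp only [hi, if_false]
      exact measurable_const

/-! ### Sub-Gaussian sums -/

/-- The noises need not be independent, so the exponential of a sum is bounded by `exp (2 * c * S) +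
exp (2 * c * |x|)`. The constant doubles in every round, which is why the induction runs over all
`c`. -/
theorem integrable_exp_sum_abs (hrun : IsDAEtCRun l h δ₀ σ B s v T₀ T P H item win noise)
    [IsProbabilityMeasure P] {k : ℕ} (hk : k ≤ T) (c : ℝ) :
    Integrable (fun ω => Real.exp (c * ∑ t ∈ Finset.range k, |noise t ω|)) P := by
  induction k generalizing c with
  | zero => simp
  | succ k ih =>
    have hN := (hrun.noise_measurable k (by omega)).mono (H.le _) le_rfl
    refine ((ih (by omega) (2 * c)).add ((hrun.noise_integrable k (by omega) (2 * c)).add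
      (hrun.noise_integrable k (by omega) (-(2 * c))))).mono' ?_ (ae_of_all _ fun ω => ?_)
    · refine Measurable.aestronglyMeasurable (Real.measurable_exp.comp (Measurable.const_mul ?_ _))
      refine Finset.measurable_sum _ fun t ht => ?_
      have : t < T := by rw [Finset.mem_range] at ht; omega
      exact ((hrun.noise_measurable t this).mono (H.le _) le_rfl).abs
    · rw [Real.norm_of_nonneg (Real.exp_pos _).le, Finset.sum_range_succ]
      simp only [Pi.add_apply]
      set S := ∑ t ∈ Finset.range k, |noise t ω|
      have h1 : Real.exp (c * (S + |noise k ω|))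
          ≤ Real.exp (2 * c * S) + Real.exp (2 * c * |noise k ω|) := by
        rcases le_total (c * S) (c * |noise k ω|) with h | h
        · have : Real.exp (c * (S + |noise k ω|)) ≤ Real.exp (2 * c * |noise k ω|) :=
            Real.exp_le_exp.2 (by linarith)
          linarith [Real.exp_pos (2 * c * S)]
        · have : Real.exp (c * (S + |noise k ω|)) ≤ Real.exp (2 * c * S) :=
            Real.exp_le_exp.2 (by linarith)
          linarith [Real.exp_pos (2 * c * |noise k ω|)]
      have h2 : Real.exp (2 * c * |noise k ω|)
          ≤ Real.exp (2 * c * noise k ω) + Real.exp (-(2 * c) * noise k ω) := by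
        rcases abs_cases (noise k ω) with ⟨h, -⟩ | ⟨h, -⟩
        · rw [h]; linarith [Real.exp_pos (-(2 * c) * noise k ω)]
        · rw [h, mul_neg, ← neg_mul]; linarith [Real.exp_pos (2 * c * noise k ω)]
      linarith

/-- The exponential supermartingale of the noise, restricted to the rounds selected by `A`. -/
theorem integral_exp_noise_le_one (hrun : IsDAEtCRun l h δ₀ σ B s v T₀ T P H item win noise)
    [IsProbabilityMeasure P] (A : Fin n → Fin m → Prop) [∀ i j, Decidable (A i j)] {M : ℝ}
    (hM : σ ^ 2 ≤ M) (c : ℝ) {k : ℕ} (hk : k ≤ T) :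
    Integrable (fun ω => Real.exp (∑ t ∈ Finset.range k,
        if A (win t ω) (item t ω) then c * noise t ω - c ^ 2 * M / 2 else 0)) P ∧
      ∫ ω, Real.exp (∑ t ∈ Finset.range k,
        if A (win t ω) (item t ω) then c * noise t ω - c ^ 2 * M / 2 else 0) ∂P ≤ 1 := by
  have hM0 : 0 ≤ M := (sq_nonneg σ).trans hM
  have hmeas : ∀ k ≤ T, Measurable[H k] fun ω => Real.exp (∑ t ∈ Finset.range k,
      if A (win t ω) (item t ω) then c * noise t ω - c ^ 2 * M / 2 else 0) := fun k hk =>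
    Real.measurable_exp.comp (hrun.measurable_sum hk
      (f := fun i j x => if A i j then c * x - c ^ 2 * M / 2 else 0)
      (fun i j => by split_ifs <;> fun_prop))
  have hintegrable : ∀ k ≤ T, Integrable (fun ω => Real.exp (∑ t ∈ Finset.range k,
      if A (win t ω) (item t ω) then c * noise t ω - c ^ 2 * M / 2 else 0)) P := by
    intro k hk
    refine (hrun.integrable_exp_sum_abs hk |c|).mono'
      ((hmeas k hk).mono (H.le k) le_rfl).aestronglyMeasurable (ae_of_all _ fun ω => ?_)
    rw [Real.norm_of_nonneg (Real.exp_pos _).le, Finset.mul_sum]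
    refine Real.exp_le_exp.2 (Finset.sum_le_sum fun t _ => ?_)
    rw [← abs_mul]
    split_ifs
    · have : 0 ≤ c ^ 2 * M / 2 := by positivity
      linarith [le_abs_self (c * noise t ω)]
    · exact abs_nonneg _
  refine ⟨hintegrable k hk, ?_⟩
  induction k with
  | zero => simp
  | succ k ih =>
    refine le_trans ?_ (ih (by omega))
    set Y : Ω → ℝ := fun ω => Real.exp (∑ t ∈ Finset.range k,
      if A (win t ω) (item t ω) then c * noise t ω - c ^ 2 * M / 2 else 0) with hY
    have hi := hrun.item_measurable k (by omega)
    have hw := hrun.win_measurable k (by omega)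
    have hGle : infoBeforeNoise H item win k ≤ mΩ :=
      sup_le (sup_le (H.le k) ((hi.mono (H.le _) le_rfl).comap_le)) ((hw.mono (H.le _) le_rfl).comap_le)
    have hiG : Measurable[infoBeforeNoise H item win k] (item k) := fun s hs =>
      (le_sup_right.trans le_sup_left : MeasurableSpace.comap (item k) ⊤
        ≤ infoBeforeNoise H item win k) _ ⟨s, trivial, rfl⟩
    have hwG : Measurable[infoBeforeNoise H item win k] (win k) := fun s hs =>
      (le_sup_right : MeasurableSpace.comap (win k) ⊤
        ≤ infoBeforeNoise H item win k) _ ⟨s, trivial, rfl⟩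
    have hYG : Measurable[infoBeforeNoise H item win k] Y :=
      (hmeas k (by omega)).mono (le_sup_left.trans le_sup_left) le_rfl
    -- A selected round multiplies `Y` by the compensated exponential, and any other round leaves it
    -- unchanged: `W` and `V` are these two cases, both known before the noise is drawn.
    set W : Ω → ℝ := fun ω => if A (win k ω) (item k ω) then
      Y ω * Real.exp (-(c ^ 2 * M / 2)) else 0 with hW
    set V : Ω → ℝ := fun ω => if A (win k ω) (item k ω) then 0 else Y ω with hV
    have hWG : Measurable[infoBeforeNoise H item win k] W := measurable_apply_fin
      (f := fun i j ω => if A i j then Y ω * Real.exp (-(c ^ 2 * M / 2)) else 0) hwG hiG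
      fun i j => by
        by_cases hA : A i j
        · simp only [hA, if_true]; exact hYG.mul_const _
        · simp only [hA, if_false]; exact measurable_const
    have hVG : Measurable[infoBeforeNoise H item win k] V := measurable_apply_fin
      (f := fun i j ω => if A i j then 0 else Y ω) hwG hiG
      fun i j => by
        by_cases hA : A i j
        · simp only [hA, if_true]; exact measurable_const
        · simp only [hA, if_false]; exact hYG
    set E : Ω → ℝ := fun ω => Real.exp (c * noise k ω) with hE
    have hYpos : ∀ ω, 0 < Y ω := fun ω => Real.exp_pos _
    have hW0 : ∀ ω, 0 ≤ W ω := fun ω => by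
      simp only [hW]; split_ifs
      · exact (mul_pos (hYpos ω) (Real.exp_pos _)).le
      · exact le_rfl
    have hYint : Integrable Y P := hintegrable k (by omega)
    have hVint : Integrable V P := hYint.mono (hVG.mono hGle le_rfl).aestronglyMeasurable
      (ae_of_all _ fun ω => by
        simp only [hV]; split_ifs
        · simp
        · exact le_rfl)
    have hdecomp : ∀ ω, Real.exp (∑ t ∈ Finset.range (k + 1),
        if A (win t ω) (item t ω) then c * noise t ω - c ^ 2 * M / 2 else 0)
        = V ω + (W * E) ω := by
      intro ω
      rw [Finset.sum_range_succ, Real.exp_add]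
      simp only [hV, hW, hE, Pi.mul_apply]
      by_cases hA : A (win k ω) (item k ω)
      · simp only [hA, if_true, zero_add]
        rw [sub_eq_add_neg, Real.exp_add]
        ring
      · simp [hA, hY]
    have hWEint : Integrable (W * E) P := by
      refine (hintegrable (k + 1) hk).mono ((hWG.mono hGle le_rfl).mul
        (Real.measurable_exp.comp (((hrun.noise_measurable k (by omega)).mono
          (H.le _) le_rfl).const_mul c))).aestronglyMeasurable (ae_of_all _ fun ω => ?_)
      rw [Real.norm_of_nonneg (Real.exp_pos _).le, hdecomp ω,
        Real.norm_of_nonneg (show 0 ≤ (W * E) ω from mul_nonneg (hW0 ω) (Real.exp_pos _).le)]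
      have : 0 ≤ V ω := by
        simp only [hV]; split_ifs
        · exact le_rfl
        · exact (hYpos ω).le
      linarith
    have hEint : Integrable E P := hrun.noise_integrable k (by omega) c
    simp_rw [hdecomp]
    rw [integral_add hVint hWEint]
    have hbound : ∀ ω, W ω * Real.exp (c ^ 2 * σ ^ 2 / 2) ≤ Y ω - V ω := by
      intro ω
      simp only [hW, hV]
      split_ifs
      · rw [mul_assoc, ← Real.exp_add, sub_zero]
        refine mul_le_of_le_one_right (hYpos ω).le (Real.exp_le_one_iff.2 ?_)
        nlinarith [mul_le_mul_of_nonneg_left hM (sq_nonneg c)]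
      · simp
    have h1 : ∫ ω, (W * E) ω ∂P ≤ ∫ ω, (Y ω - V ω) ∂P :=
      integral_mul_le_of_condExp_le hGle hWG hW0 hWEint hEint (hYint.sub hVint) hbound
        (hrun.noise_subgaussian k (by omega) c)
    rw [integral_sub hYint hVint] at h1
    linarith

/-- Apply `|z| ≤ exp z + exp (-z)` to `z = S / √T`. With `c ^ 2 * T = 1` the compensators of all `T`
rounds add up to `σ ^ 2 / 2`, so both exponential moments are bounded. -/
theorem integral_abs_noise_le (hrun : IsDAEtCRun l h δ₀ σ B s v T₀ T P H item win noise)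
    [IsProbabilityMeasure P] (hT : 0 < T) (i : Fin n) :
    Integrable (fun ω => |∑ t ∈ Finset.range T, if win t ω = i then noise t ω else 0|) P ∧
      ∫ ω, |∑ t ∈ Finset.range T, if win t ω = i then noise t ω else 0| ∂P
        ≤ 2 * Real.exp (σ ^ 2 / 2) * Real.sqrt T := by
  have hT' : (0 : ℝ) < T := by exact_mod_cast hT
  have hsq : 0 < Real.sqrt T := Real.sqrt_pos.2 hT'
  set S : Ω → ℝ := fun ω => ∑ t ∈ Finset.range T, if win t ω = i then noise t ω else 0 with hS
  have hSm : Measurable S := (hrun.measurable_sum le_rfl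
    (f := fun i' _ x => if i' = i then x else 0)
    (fun i' j => by split_ifs <;> fun_prop)).mono (H.le T) le_rfl
  have hA := fun c => hrun.integral_exp_noise_le_one (fun i' _ => i' = i) le_rfl c (le_refl T)
  set Z : ℝ → Ω → ℝ := fun c ω => Real.exp (∑ t ∈ Finset.range T,
        if win t ω = i then c * noise t ω - c ^ 2 * σ ^ 2 / 2 else 0) with hZ
  have hexp : ∀ c : ℝ, c ^ 2 * T = 1 → ∀ ω, Real.exp (c * S ω) ≤ Real.exp (σ ^ 2 / 2) * Z c ω := by
    intro c hc ω
    rw [hZ, ← Real.exp_add]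
    refine Real.exp_le_exp.2 ?_
    have h1 : σ ^ 2 / 2 = ∑ t ∈ Finset.range T, c ^ 2 * σ ^ 2 / 2 := by
      rw [Finset.sum_const, Finset.card_range, nsmul_eq_mul]
      linear_combination (-σ ^ 2 / 2) * hc
    rw [h1, ← Finset.sum_add_distrib, hS, Finset.mul_sum]
    refine Finset.sum_le_sum fun t _ => ?_
    have : 0 ≤ c ^ 2 * σ ^ 2 / 2 := by positivity
    split_ifs <;> linarith
  set d := 1 / Real.sqrt T with hd
  have hd1 : d ^ 2 * T = 1 := by
    rw [hd, div_pow, Real.sq_sqrt hT'.le]; field_simp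
  have hpt : ∀ ω, |S ω| ≤ Real.sqrt T * (Real.exp (σ ^ 2 / 2) * Z d ω
      + Real.exp (σ ^ 2 / 2) * Z (-d) ω) := by
    intro ω
    have h1 := hexp d hd1 ω
    have h2 := hexp (-d) (by rw [neg_sq]; exact hd1) ω
    have h3 : |S ω| = Real.sqrt T * |d * S ω| := by
      rw [abs_mul, abs_of_nonneg (by positivity : 0 ≤ d), hd]; field_simp
    rw [h3]
    refine mul_le_mul_of_nonneg_left ?_ hsq.le
    have h4 := Real.add_one_le_exp (d * S ω)
    have h5 := Real.add_one_le_exp (-d * S ω)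
    have h6 := Real.exp_pos (d * S ω)
    have h7 := Real.exp_pos (-d * S ω)
    rw [abs_le]
    constructor <;> linarith
  have hbint : Integrable (fun ω => Real.sqrt T * (Real.exp (σ ^ 2 / 2) * Z d ω
      + Real.exp (σ ^ 2 / 2) * Z (-d) ω)) P :=
    (((hA d).1.const_mul _).add ((hA (-d)).1.const_mul _)).const_mul _
  refine ⟨hbint.mono' hSm.abs.aestronglyMeasurable (ae_of_all _ fun ω => ?_), ?_⟩
  · rw [Real.norm_eq_abs, abs_abs]; exact hpt ω
  · refine (integral_mono_of_nonneg (ae_of_all _ fun ω => abs_nonneg _) hbint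
      (ae_of_all _ hpt)).trans ?_
    rw [integral_const_mul, integral_add ((hA d).1.const_mul _) ((hA (-d)).1.const_mul _),
      integral_const_mul, integral_const_mul]
    have h1 := mul_le_mul_of_nonneg_left (hA d).2 (Real.exp_pos (σ ^ 2 / 2)).le
    have h2 := mul_le_mul_of_nonneg_left (hA (-d)).2 (Real.exp_pos (σ ^ 2 / 2)).le
    nlinarith [mul_le_mul_of_nonneg_left (add_le_add h1 h2) hsq.le]

end IsDAEtCRun

/-! ### The exploration phase -/

theorem count_succ (item : ℕ → Fin m) (win : ℕ → Fin n) (k : ℕ) (i : Fin n) (j : Fin m) :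
    count item win (k + 1) i j
      = count item win k i j + if win k = i ∧ item k = j then 1 else 0 := by
  simp only [count, Finset.range_add_one, Finset.filter_insert]
  split_ifs with hc
  · rw [Finset.card_insert_of_notMem (by simp)]
  · simp

theorem natCast_count (item : ℕ → Fin m) (win : ℕ → Fin n) (k : ℕ) (i : Fin n) (j : Fin m) :
    (count item win k i j : ℝ)
      = ∑ t ∈ Finset.range k, if win t = i ∧ item t = j then 1 else 0 := by
  rw [count, Finset.card_filter]
  push_cast
  rfl

theorem estimator_sub_eq (v : Fin n → Fin m → ℝ) (item : ℕ → Fin m) (win : ℕ → Fin n)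
    (noise : ℕ → ℝ) (k : ℕ) (i : Fin n) (j : Fin m) (hc : (count item win k i j : ℝ) ≠ 0) :
    (estimator v item win noise k i j - v i j) * count item win k i j
      = ∑ t ∈ Finset.range k, if win t = i ∧ item t = j then noise t else 0 := by
  rw [sub_mul, estimator, div_mul_cancel₀ _ hc, natCast_count, Finset.mul_sum,
    ← Finset.sum_sub_distrib]
  refine Finset.sum_congr rfl fun t _ => ?_
  split_ifs with h1
  · rw [utility, h1.1, h1.2]; ring
  · ring

/-- The exponential bounds on the noise control the error of the estimator. -/
theorem estimator_sub_le {S N M μ L ε : ℝ} (hM : 0 < M) (hε : 0 < ε)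
    (hN : μ / 2 < N) (hεL : ε ^ 2 * μ = 4 * L * M)
    (hS : ε / M * S - (ε / M) ^ 2 * M / 2 * N < L) : S ≤ ε * N := by
  have h1 : ε / M * S - (ε / M) ^ 2 * M / 2 * N = (ε * S - ε ^ 2 / 2 * N) / M := by
    field_simp
  rw [h1, div_lt_iff₀ hM] at hS
  have h2 : ε ^ 2 * (μ / 2) ≤ ε ^ 2 * N := by gcongr
  have h3 : ε * S ≤ ε * (ε * N) := by nlinarith
  exact le_of_mul_le_mul_left h3 hε

/-- Closes Markov's inequality for `(1 / 2) ^ count`: the slack `(1 - log 2) * μ / 2` exceeds `L`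
once `μ ≥ 16 * L`. -/
theorem exp_count_bound {μ L : ℝ} (hμ : 16 * L ≤ μ) (hL : 0 ≤ L) :
    Real.exp (-(μ / 2)) ≤ Real.exp (-L) * (1 / 2 : ℝ) ^ (μ / 2) := by
  rw [Real.rpow_def_of_pos (by norm_num), ← Real.exp_add]
  refine Real.exp_le_exp.2 ?_
  have h1 : Real.log (1 / 2) = -Real.log 2 := by rw [one_div, Real.log_inv]
  have := Real.log_two_lt_d9
  rw [h1]
  nlinarith

namespace IsDAEtCRun

variable {l h δ₀ σ : ℝ} {B : Fin n → ℝ} {s : Fin m → ℝ} {v : Fin n → Fin m → ℝ} {T₀ T : ℕ}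
  {Ω : Type*} {mΩ : MeasurableSpace Ω} {P : Measure Ω} {H : Filtration ℕ mΩ}
  {item : ℕ → Ω → Fin m} {win : ℕ → Ω → Fin n} {noise : ℕ → Ω → ℝ}

theorem integral_mul_item (hrun : IsDAEtCRun l h δ₀ σ B s v T₀ T P H item win noise)
    [IsProbabilityMeasure P] (hs : ∀ j, s j = 1 / m) {t : ℕ} (ht : t < T) {f : Ω → ℝ}
    (hf : Measurable[H t] f) (q : Fin m → ℝ) :
    ∫ ω, f ω * q (item t ω) ∂P = (∫ ω, f ω ∂P) * ∑ j, 1 / m * q j := by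
  rw [integral_mul_comp_of_indep (H.le t) ((hrun.item_measurable t ht).mono (H.le _) le_rfl)
    (hrun.item_indep t ht) hf q]
  congr 1
  refine Finset.sum_congr rfl fun j _ => ?_
  rw [measureReal_def, hrun.item_law t ht, hs, ENNReal.toReal_ofReal (by positivity)]

/-- Each exploration round hits the pair with probability `1 / (n * m)`, independently of the past,
and a hit halves the variable. This gives a Chernoff bound for the lower tail of the count. -/
theorem integral_half_pow_count (hrun : IsDAEtCRun l h δ₀ σ B s v T₀ T P H item win noise)
    [IsProbabilityMeasure P] (hs : ∀ j, s j = 1 / m) (hT : T₀ ≤ T) (i : Fin n) (j : Fin m)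
    {k : ℕ} (hk : k ≤ T₀) :
    Integrable (fun ω =>
        (1 / 2 : ℝ) ^ count (fun τ => item τ ω) (fun τ => win τ ω) k i j) P ∧
      ∫ ω, (1 / 2 : ℝ) ^ count (fun τ => item τ ω) (fun τ => win τ ω) k i j ∂P
        = (1 - 1 / (2 * (n * m))) ^ k := by
  have hmeas : ∀ k ≤ T₀, Measurable[H k] fun ω =>
      (1 / 2 : ℝ) ^ count (fun τ => item τ ω) (fun τ => win τ ω) k i j := by
    intro k hk
    have h1 := hrun.measurable_count (hk.trans hT) i j
    have h2 : Measurable fun x : ℝ => (1 / 2 : ℝ) ^ x := by fun_prop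
    have h3 := h2.comp h1
    simpa [Function.comp_def, Real.rpow_natCast] using h3
  have hintegrable : ∀ k ≤ T₀, Integrable (fun ω =>
      (1 / 2 : ℝ) ^ count (fun τ => item τ ω) (fun τ => win τ ω) k i j) P := by
    intro k hk
    refine (integrable_const (1 : ℝ)).mono' ((hmeas k hk).mono (H.le k) le_rfl).aestronglyMeasurable
      (ae_of_all _ fun ω => ?_)
    rw [Real.norm_of_nonneg (by positivity)]
    exact pow_le_one₀ (by norm_num) (by norm_num)
  refine ⟨hintegrable k hk, ?_⟩
  induction k with
  | zero => simp [count]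
  | succ k ih =>
    have hkT : k < T := by omega
    have ih := ih (by omega)
    set f : Ω → ℝ := fun ω =>
      (1 / 2 : ℝ) ^ count (fun τ => item τ ω) (fun τ => win τ ω) k i j with hf
    set qi : Fin n → ℝ := fun i' => if i' = i then 1 else 0 with hqi
    set qj : Fin m → ℝ := fun j' => if j' = j then 1 else 0 with hqj
    have hi := hrun.item_measurable k hkT
    have hw := (hrun.win_measurable k hkT).mono (H.le _) le_rfl
    have hstep : ∀ ω, (1 / 2 : ℝ) ^ count (fun τ => item τ ω) (fun τ => win τ ω) (k + 1) i j
        = f ω - 1 / 2 * (f ω * qj (item k ω) * qi (win k ω)) := by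
      intro ω
      rw [count_succ]
      simp only [hf, hqi, hqj]
      by_cases h1 : win k ω = i <;> by_cases h2 : item k ω = j <;> simp [h1, h2, pow_succ]
      ring
    have h1 : ∫ ω, f ω * qj (item k ω) * qi (win k ω) ∂P
        = (∫ ω, f ω * qj (item k ω) ∂P) * (n : ℝ)⁻¹ := by
      rw [integral_mul_comp_of_indep (m' := H k ⊔ MeasurableSpace.comap (item k) ⊤)
        (sup_le (H.le k) (hi.mono (H.le _) le_rfl).comap_le) hw
        (hrun.explore_indep k (by omega) hkT) ?_ qi]
      · congr 1
        rw [Finset.sum_eq_single i]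
        · simp [hqi, measureReal_def, hrun.explore_law k (by omega) hkT]
        · intro i' _ hi'
          simp [hqi, hi']
        · simp
      · refine Measurable.mul ((hmeas k (by omega)).mono le_sup_left le_rfl) ?_
        have : Measurable[MeasurableSpace.comap (item k) ⊤] fun ω => qj (item k ω) :=
          fun t _ => ⟨qj ⁻¹' t, trivial, rfl⟩
        exact this.mono le_sup_right le_rfl
    have h2 : ∫ ω, f ω * qj (item k ω) ∂P = (∫ ω, f ω ∂P) * (m : ℝ)⁻¹ := by
      rw [hrun.integral_mul_item hs hkT (hmeas k (by omega)) qj]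
      congr 1
      rw [Finset.sum_eq_single j]
      · simp [hqj]
      · intro j' _ hj'
        simp [hqj, hj']
      · simp
    have h3 : Integrable (fun ω => 1 / 2 * (f ω * qj (item k ω) * qi (win k ω))) P := by
      have := (hintegrable k (by omega)).sub (hintegrable (k + 1) hk)
      refine this.congr (ae_of_all _ fun ω => ?_)
      simp only [Pi.sub_apply]
      rw [hstep ω]
      ring
    simp_rw [hstep]
    rw [integral_sub (hintegrable k (by omega)) h3, integral_const_mul, h1, h2, ih, pow_succ,
      one_div (2 * ((n : ℝ) * m)), mul_inv, mul_inv]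
    ring

/-- After the exploration phase, all estimates are accurate with high probability. -/
theorem measure_estimator_error_le (hrun : IsDAEtCRun l h δ₀ σ B s v T₀ T P H item win noise)
    [IsProbabilityMeasure P] (hs : ∀ j, s j = 1 / m) (hn : 0 < n) (hm : 0 < m) (hT₀ : 0 < T₀)
    (hT : T₀ ≤ T) {ε : ℝ}
    (hε : ε = Real.sqrt (8 * max 1 (σ ^ 2) * (n * m) * Real.log (n * m * T) / T₀))
    (hε1 : ε ≤ 1 / 2) :
    P.real {ω | ¬ ∀ i j, |estimator v (fun τ => item τ ω) (fun τ => win τ ω)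
      (fun τ => noise τ ω) T₀ i j - v i j| ≤ ε} ≤ 3 / T := by
  have hn' : (1 : ℝ) ≤ n := by exact_mod_cast hn
  have hm' : (1 : ℝ) ≤ m := by exact_mod_cast hm
  have hT₀' : (0 : ℝ) < T₀ := by exact_mod_cast hT₀
  have hT1 : (1 : ℝ) ≤ T := by exact_mod_cast (hT₀.trans_le hT)
  have hnm : (1 : ℝ) ≤ n * m := by nlinarith
  -- If `n * m * T = 1` the logarithm vanishes, but then the claimed bound is `3`.
  rcases (show (1 : ℝ) ≤ n * m * T by nlinarith).eq_or_lt with hone | hgt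
  · have : (T : ℝ) = 1 := by nlinarith
    rw [this]
    linarith [measureReal_le_one (μ := P) (s := {ω | ¬ ∀ i j, |estimator v (fun τ => item τ ω)
      (fun τ => win τ ω) (fun τ => noise τ ω) T₀ i j - v i j| ≤ ε})]
  set M := max 1 (σ ^ 2) with hM
  have hM1 : 1 ≤ M := le_max_left _ _
  -- The factor `2` makes `exp (-L) = (n * m * T)⁻²`, which leaves room for a union over `n * m`
  -- pairs.
  set L := 2 * Real.log (n * m * T) with hL
  have hLpos : 0 < L := by have := Real.log_pos hgt; positivity
  set μ := (T₀ : ℝ) / (n * m) with hμ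
  have hμpos : 0 < μ := by positivity
  have hε2 : ε ^ 2 * μ = 4 * L * M := by
    rw [hε, Real.sq_sqrt (by have := Real.log_pos hgt; positivity), hμ, hL]
    field_simp
    ring
  have hεpos : 0 < ε := by
    rw [hε]; exact Real.sqrt_pos.2 (by have := Real.log_pos hgt; positivity)
  -- From `ε ^ 2 * μ = 4 * L * M`, `ε ≤ 1 / 2` and `M ≥ 1`.
  have hμL : 16 * L ≤ μ := by
    have h1 : ε ^ 2 ≤ 1 / 4 := by nlinarith
    nlinarith
  set cnt : Fin n → Fin m → Ω → ℕ := fun i j ω =>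
    count (fun τ => item τ ω) (fun τ => win τ ω) T₀ i j with hcnt
  set Z : ℝ → Fin n → Fin m → Ω → ℝ := fun c i j ω => Real.exp (∑ t ∈ Finset.range T₀,
    if win t ω = i ∧ item t ω = j then c * noise t ω - c ^ 2 * M / 2 else 0) with hZ
  have hZsum : ∀ c i j ω, ∑ t ∈ Finset.range T₀,
      (if win t ω = i ∧ item t ω = j then c * noise t ω - c ^ 2 * M / 2 else 0)
      = c * (∑ t ∈ Finset.range T₀, if win t ω = i ∧ item t ω = j then noise t ω else 0)
        - c ^ 2 * M / 2 * cnt i j ω := by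
    intro c i j ω
    rw [hcnt, natCast_count, Finset.mul_sum, Finset.mul_sum, ← Finset.sum_sub_distrib]
    exact Finset.sum_congr rfl fun t _ => by split_ifs <;> ring
  -- An estimate can fail only if the pair has at most half its expected number `μ` of samples, or
  -- if the noise sum is too large in one of the two directions, tested with the tilt `± ε / M`.
  have hsub : {ω | ¬ ∀ i j, |estimator v (fun τ => item τ ω) (fun τ => win τ ω)
      (fun τ => noise τ ω) T₀ i j - v i j| ≤ ε}
      ⊆ ⋃ x : Fin n × Fin m, ({ω | (1 / 2 : ℝ) ^ (μ / 2) ≤ (1 / 2 : ℝ) ^ cnt x.1 x.2 ω}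
        ∪ {ω | Real.exp L ≤ Z (ε / M) x.1 x.2 ω}) ∪ {ω | Real.exp L ≤ Z (-(ε / M)) x.1 x.2 ω} := by
    intro ω hω
    by_contra hcon
    simp only [Set.mem_iUnion, Set.mem_union, Set.mem_ofPred_eq, not_exists, not_or, not_le] at hcon
    refine hω fun i j => ?_
    obtain ⟨⟨h1, h2⟩, h3⟩ := hcon (i, j)
    have hN : μ / 2 < cnt i j ω := by
      by_contra hcc
      push Not at hcc
      refine absurd h1 (not_lt.2 ?_)
      rw [← Real.rpow_natCast]
      exact Real.rpow_le_rpow_of_exponent_ge (by norm_num) (by norm_num) hcc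
    have hNpos : (0 : ℝ) < cnt i j ω := by linarith
    rw [hZ, Real.exp_lt_exp, hZsum] at h2 h3
    have hdiff := estimator_sub_eq v (fun τ => item τ ω) (fun τ => win τ ω) (fun τ => noise τ ω)
      T₀ i j hNpos.ne'
    have h4 := estimator_sub_le (by linarith) hεpos hN hε2 h2
    have h5 := estimator_sub_le (S := -∑ t ∈ Finset.range T₀,
      if win t ω = i ∧ item t ω = j then noise t ω else 0) (by linarith) hεpos hN hε2 (by
        rw [neg_mul, neg_sq] at h3
        rwa [mul_neg])
    rw [← hdiff] at h4 h5
    rw [abs_le]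
    constructor
    · refine le_of_mul_le_mul_right ?_ hNpos
      linarith
    · exact le_of_mul_le_mul_right h4 hNpos
  have hp1 : ∀ i j, P.real {ω | (1 / 2 : ℝ) ^ (μ / 2) ≤ (1 / 2 : ℝ) ^ cnt i j ω}
      ≤ Real.exp (-L) := by
    intro i j
    have hc := hrun.integral_half_pow_count hs hT i j le_rfl
    have h1 := mul_meas_ge_le_integral_of_nonneg (ae_of_all _ fun ω => by positivity) hc.1
      ((1 / 2 : ℝ) ^ (μ / 2))
    rw [hc.2] at h1
    have h2 : (1 - 1 / (2 * ((n : ℝ) * m))) ^ T₀ ≤ Real.exp (-(μ / 2)) := by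
      have h3 : -(μ / 2) = T₀ * (-(1 / (2 * ((n : ℝ) * m)))) := by
        rw [hμ]; field_simp
      rw [h3, Real.exp_nat_mul]
      refine pow_le_pow_left₀ ?_ ?_ _
      · rw [sub_nonneg, div_le_one (by positivity)]; linarith
      · have := Real.add_one_le_exp (-(1 / (2 * ((n : ℝ) * m))))
        linarith
    have h4 := h1.trans (h2.trans (exp_count_bound hμL hLpos.le))
    rw [mul_comm (Real.exp (-L))] at h4
    exact le_of_mul_le_mul_left h4 (by positivity)
  have hp2 : ∀ c i j, P.real {ω | Real.exp L ≤ Z c i j ω} ≤ Real.exp (-L) := by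
    intro c i j
    have hc := hrun.integral_exp_noise_le_one (fun i' j' => i' = i ∧ j' = j)
      (le_max_right 1 (σ ^ 2)) c hT
    have h1 := mul_meas_ge_le_integral_of_nonneg (ae_of_all _ fun ω => (Real.exp_pos _).le) hc.1
      (Real.exp L)
    rw [Real.exp_neg, ← one_div, le_div_iff₀ (Real.exp_pos _), mul_comm]
    exact h1.trans hc.2
  refine (measureReal_mono hsub).trans ((measureReal_iUnion_fintype_le _).trans ?_)
  have hexpL : Real.exp (-L) = ((n * m * T : ℝ) ^ 2)⁻¹ := by
    have : Real.exp L = (n * m * T : ℝ) ^ 2 := by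
      rw [hL, two_mul, Real.exp_add, Real.exp_log (by positivity), sq]
    rw [Real.exp_neg, this]
  calc _ ≤ ∑ x : Fin n × Fin m, 3 * Real.exp (-L) := by
        refine Finset.sum_le_sum fun x _ => ?_
        refine (measureReal_union_le _ _).trans ?_
        have := measureReal_union_le (μ := P)
          {ω | (1 / 2 : ℝ) ^ (μ / 2) ≤ (1 / 2 : ℝ) ^ cnt x.1 x.2 ω}
          {ω | Real.exp L ≤ Z (ε / M) x.1 x.2 ω}
        linarith [hp1 x.1 x.2, hp2 (ε / M) x.1 x.2, hp2 (-(ε / M)) x.1 x.2]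
    _ = 3 / (n * m * T * T) := by
        simp only [Finset.sum_const, Finset.card_univ, Fintype.card_prod, Fintype.card_fin,
          nsmul_eq_mul]
        rw [hexpL]
        push_cast
        field_simp
    _ ≤ 3 / T := by
        refine div_le_div_of_nonneg_left (by norm_num) (by linarith) ?_
        exact le_mul_of_one_le_left (by linarith) hgt.le

end IsDAEtCRun

/-! ### The regret on a path with accurate estimates -/

theorem sum_one_div_le_one_add_log (R : ℕ) :
    ∑ r ∈ Finset.range R, 1 / ((r : ℝ) + 1) ≤ 1 + Real.log R := by
  refine le_of_eq_of_le ?_ (harmonic_le_one_add_log R)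
  rw [harmonic]
  push_cast
  exact Finset.sum_congr rfl fun r _ => one_div _

theorem neg_log_one_sub_le {η : ℝ} (hη0 : 0 ≤ η) (hη : η ≤ 1 / 2) :
    -Real.log (1 - η) ≤ 2 * η := by
  have h1 := Real.one_sub_inv_le_log_of_pos (show 0 < 1 - η by linarith)
  have h2 : (1 - η)⁻¹ ≤ 1 + 2 * η := by
    rw [inv_le_iff_one_le_mul₀ (by linarith)]
    nlinarith
  linarith

/-- The total noise of the items received by agent `i`. -/
def cumNoise (win : ℕ → Fin n) (noise : ℕ → ℝ) (T : ℕ) (i : Fin n) : ℝ :=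
  ∑ t ∈ Finset.range T, if win t = i then noise t else 0

theorem cumUtility_eq (v : Fin n → Fin m → ℝ) (item : ℕ → Fin m) (win : ℕ → Fin n)
    (noise : ℕ → ℝ) (T : ℕ) (i : Fin n) :
    cumUtility v item win noise T i
      = (∑ t ∈ Finset.range T, if win t = i then v i (item t) else 0)
        + cumNoise win noise T i := by
  rw [cumUtility, cumNoise, ← Finset.sum_add_distrib]
  refine Finset.sum_congr rfl fun t _ => ?_
  split_ifs with hw
  · rw [utility, hw]
  · simp

/-- Overestimation by `1 + η` is undone by `(1 - η) * (1 + η) ≤ 1`; the nonnegative values collected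
during exploration are simply dropped. -/
theorem mul_daMean_sub_le_cumUtility {v vhat : Fin n → Fin m → ℝ} {η : ℝ}
    (hv : ∀ i j, 0 ≤ v i j) (hη : η ≤ 1 / 2)
    (hvhat : ∀ i j, vhat i j ≤ (1 + η) * v i j) (item : ℕ → Fin m) (win : ℕ → Fin n)
    (noise : ℕ → ℝ) (T₀ R : ℕ) (i : Fin n) :
    (1 - η) * (R * daMean vhat (fun r => item (T₀ + r)) (fun r => win (T₀ + r)) R i)
      - |cumNoise win noise (T₀ + R) i| ≤ cumUtility v item win noise (T₀ + R) i := by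
  have h1 := cumUtility_eq v item win noise (T₀ + R) i
  have h2 : (1 - η) * (R * daMean vhat (fun r => item (T₀ + r)) (fun r => win (T₀ + r)) R i)
      ≤ ∑ t ∈ Finset.range (T₀ + R), if win t = i then v i (item t) else 0 := by
    rw [mul_daMean, Finset.sum_range_add, Finset.mul_sum]
    have h3 : 0 ≤ ∑ t ∈ Finset.range T₀, if win t = i then v i (item t) else 0 :=
      Finset.sum_nonneg fun t _ => by split_ifs <;> simp [hv]
    refine le_trans (Finset.sum_le_sum fun r _ => ?_) (le_add_of_nonneg_left h3)
    split_ifs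
    · have h4 := hvhat i (item (T₀ + r))
      have h5 := hv i (item (T₀ + r))
      nlinarith [mul_le_mul_of_nonneg_left h4 (show 0 ≤ 1 - η by linarith),
        mul_nonneg (sq_nonneg η) h5]
    · simp
  linarith [neg_abs_le (cumNoise win noise (T₀ + R) i)]

/-- Bound on the regret of a path on which the estimates `vhat` are accurate up to a factor `1 ± η`.
Here `x`, `u`, `p` are the allocation, the utilities and the prices of a market equilibrium, and
`w` is its Nash social welfare. -/
theorem regret_le_of_accurate {v vhat : Fin n → Fin m → ℝ} {l h a η w κ : ℝ} (hn : 0 < n)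
    (hl : 0 < l) (hh : 0 ≤ h) (ha : 0 < a) (hal : a ≤ l / n) (hv : ∀ i j, 0 ≤ v i j)
    (hη0 : 0 ≤ η) (hη : η ≤ 1 / 2) (hvhat : ∀ i j, vhat i j ∈ Set.Icc 0 h)
    (hlow : ∀ i j, (1 - η) * v i j ≤ vhat i j) (hupp : ∀ i j, vhat i j ≤ (1 + η) * v i j)
    {x : Fin n → Fin m → ℝ} (hx : Feasible x) {u : Fin n → ℝ} (hu : ∀ i, 2 * l / n ≤ u i)
    (hw : w = ∏ i, (u i) ^ (1 / n : ℝ)) {p : Fin m → ℝ} (hp : ∀ i j, v i j / (n * u i) ≤ p j)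
    (hκ : κ = 6 * n * (1 + h / (2 * l)))
    (item : ℕ → Fin m) (win : ℕ → Fin n) (noise : ℕ → ℝ) (T₀ R : ℕ)
    (hbid : ∀ r < R, ∀ k,
      vhat k (item (T₀ + r))
          / max (daMean vhat (fun r => item (T₀ + r)) (fun r => win (T₀ + r)) r k) a
        ≤ vhat (win (T₀ + r)) (item (T₀ + r))
          / max (daMean vhat (fun r => item (T₀ + r)) (fun r => win (T₀ + r)) r (win (T₀ + r))) a) :
    ((T₀ + R : ℕ) : ℝ) * w - ∏ i, (max (cumUtility v item win noise (T₀ + R) i) 0) ^ (1 / n : ℝ)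
      ≤ T₀ * w + R * η * (h / n) + h / n * (2 / a) * ∑ i, |cumNoise win noise (T₀ + R) i|
        + w * ((1 + κ) * (2 * η * R + (h / a) ^ 2 * (1 + Real.log R)
          - (1 - η) / n * ∑ r ∈ Finset.range R, ∑ i,
            (max (daMean vhat (fun r => item (T₀ + r)) (fun r => win (T₀ + r)) r i) a)⁻¹
              * (v i (item (T₀ + r)) * x i (item (T₀ + r)) - u i))
          + κ * ((1 + η) * (∑ r ∈ Finset.range R, p (item (T₀ + r))) - R)) := by
  have hn' : (0 : ℝ) < n := by exact_mod_cast hn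
  have hupos : ∀ i, 0 < u i := fun i => lt_of_lt_of_le (by positivity) (hu i)
  have hwpos : 0 < w := hw ▸ Finset.prod_pos fun i _ => Real.rpow_pos_of_pos (hupos i) _
  have hκ0 : 0 ≤ κ := by rw [hκ]; positivity
  have hN0 : 0 ≤ ∑ i, |cumNoise win noise (T₀ + R) i| :=
    Finset.sum_nonneg fun i _ => abs_nonneg _
  have hprod0 : 0 ≤ ∏ i, (max (cumUtility v item win noise (T₀ + R) i) 0) ^ (1 / n : ℝ) :=
    Finset.prod_nonneg fun i _ => Real.rpow_nonneg (le_max_right _ _) _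
  rcases Nat.eq_zero_or_pos R with hR | hR
  · have h1 : 0 ≤ h / n * (2 / a) * ∑ i, |cumNoise win noise (T₀ + R) i| := by positivity
    have h2 : 0 ≤ w * ((1 + κ) * (h / a) ^ 2) := by positivity
    subst hR
    simp only [Nat.cast_zero, add_zero, Finset.range_zero, Finset.sum_empty, Real.log_zero] at *
    linarith
  have hR' : (0 : ℝ) < R := by exact_mod_cast hR
  have h2a : ∀ i, 2 * a ≤ u i := fun i => by
    have : 2 * (l / n) = 2 * l / n := by ring
    linarith [hu i]
  have hpot := potential_lower_bound hvhat hh ha hlow hx (u := u)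
    (fun i => by nlinarith [h2a i, hupos i]) (fun r => item (T₀ + r)) (fun r => win (T₀ + r)) R hbid
  have hsumle := sum_daMean_le hvhat hh (fun r => item (T₀ + r)) (fun r => win (T₀ + r)) R
  have hmem := fun i => daMean_mem_Icc hvhat hh (fun r => item (T₀ + r)) (fun r => win (T₀ + r)) R i
  have hcum := mul_daMean_sub_le_cumUtility hv hη hupp item win noise T₀ R
  have hmul := mul_daMean vhat (fun r => item (T₀ + r)) (fun r => win (T₀ + r)) R
  set D := ∑ r ∈ Finset.range R, ∑ i,
    (max (daMean vhat (fun r => item (T₀ + r)) (fun r => win (T₀ + r)) r i) a)⁻¹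
      * (v i (item (T₀ + r)) * x i (item (T₀ + r)) - u i) with hD
  set ubar := daMean vhat (fun r => item (T₀ + r)) (fun r => win (T₀ + r)) R with hubar
  set Q := ∑ r ∈ Finset.range R, p (item (T₀ + r)) with hQ
  set Λ := (∑ i, Real.log (u i)) / n with hΛ
  have hlogw : Real.log w = Λ := by rw [hw, geomMean_eq_exp hupos, Real.log_exp]
  set gap := Λ - (∑ i, smoothLog a (ubar i)) / n with hgap
  -- the potential is almost optimal
  have hgap_le : R * gap ≤ 2 * η * R + (h / a) ^ 2 * (1 + Real.log R) - (1 - η) / n * D := by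
    have h1 : ∑ i, Real.log ((1 - η) * u i) = n * Real.log (1 - η) + n * Λ := by
      rw [hΛ, mul_div_cancel₀ _ hn'.ne']
      simp_rw [fun i => Real.log_mul (show (1 - η) ≠ 0 by linarith) (hupos i).ne']
      rw [Finset.sum_add_distrib]
      simp
    rw [h1] at hpot
    have h2 := neg_log_one_sub_le hη0 hη
    have h3 : n * (h / a) ^ 2 * ∑ r ∈ Finset.range R, 1 / ((r : ℝ) + 1)
        ≤ n * (h / a) ^ 2 * (1 + Real.log R) :=
      mul_le_mul_of_nonneg_left (sum_one_div_le_one_add_log R) (by positivity)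
    have h4 : n * (R * gap) = R * (n * Λ) - R * ∑ i, smoothLog a (ubar i) := by
      rw [hgap]; field_simp
    have h5 : n * ((1 - η) / n * D) = (1 - η) * D := by field_simp
    refine le_of_mul_le_mul_left ?_ hn'
    rw [h4, mul_sub _ _ ((1 - η) / n * D), h5]
    have h6 := mul_le_mul_of_nonneg_left h2 (show 0 ≤ (n : ℝ) * R by positivity)
    linarith
  -- Weak duality along the path: measured in units of `n * u i`, the value of an item to any agent
  -- is at most its equilibrium price.
  have hspend : R * ∑ i, ubar i / (n * u i) ≤ (1 + η) * Q := by
    rw [Finset.mul_sum, hQ, Finset.mul_sum]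
    calc _ = ∑ i, ∑ r ∈ Finset.range R,
          if win (T₀ + r) = i then vhat i (item (T₀ + r)) / (n * u i) else 0 := by
          refine Finset.sum_congr rfl fun i _ => ?_
          rw [← mul_div_assoc, hmul, Finset.sum_div]
          refine Finset.sum_congr rfl fun r _ => ?_
          split_ifs <;> simp
      _ = ∑ r ∈ Finset.range R, vhat (win (T₀ + r)) (item (T₀ + r)) / (n * u (win (T₀ + r))) := by
          rw [Finset.sum_comm]
          simp
      _ ≤ _ := by
          refine Finset.sum_le_sum fun r _ => ?_
          have h1 : 0 < n * u (win (T₀ + r)) := mul_pos hn' (hupos _)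
          refine le_trans (div_le_div_of_nonneg_right (hupp _ _) h1.le) ?_
          rw [mul_div_assoc]
          exact mul_le_mul_of_nonneg_left (hp _ _) (by linarith)
  have htangent : ∀ i, smoothLog a (ubar i) ≤ Real.log (u i) + (ubar i - u i) / u i := fun i =>
    smoothLog_le_tangent ha (by linarith [h2a i])
  have hsumtan : (∑ i, (Real.log (u i) + (ubar i - u i) / u i)) / n
      = Λ + ∑ i, ubar i / (n * u i) - 1 := by
    have h1 : ∀ i, Real.log (u i) + (ubar i - u i) / u i
        = Real.log (u i) + n * (ubar i / (n * u i)) - 1 := by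
      intro i
      have := (hupos i).ne'
      field_simp
      ring
    simp_rw [h1]
    rw [Finset.sum_sub_distrib, Finset.sum_add_distrib, ← Finset.mul_sum, hΛ]
    simp only [Finset.sum_const, Finset.card_univ, Fintype.card_fin, nsmul_eq_mul, mul_one]
    field_simp
  have hgap_ge : 1 - ∑ i, ubar i / (n * u i) ≤ gap := by
    have h1 := div_le_div_of_nonneg_right
      (Finset.sum_le_sum fun i (_ : i ∈ Finset.univ) => htangent i) hn'.le
    rw [hsumtan] at h1
    linarith
  have hspend0 : 0 ≤ R * gap - R + (1 + η) * Q := by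
    have := mul_le_mul_of_nonneg_left hgap_ge hR'.le
    linarith
  -- The bracket `R * gap - R + (1 + η) * Q` is the slack. It is nonnegative, so adding `κ` times it
  -- does no harm if all means reach `a`, and it covers everything if one does not.
  have hmain : (T₀ + R : ℕ) * w
        - ∏ i, (max (cumUtility v item win noise (T₀ + R) i) 0) ^ (1 / n : ℝ)
      ≤ T₀ * w + R * η * (h / n) + h / n * (2 / a) * ∑ i, |cumNoise win noise (T₀ + R) i|
        + w * (R * gap + κ * (R * gap - R + (1 + η) * Q)) := by
    push_cast
    by_cases hgood : ∀ i, a ≤ ubar i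
    · have h1 := sub_geomMean_le hn hR' ha hwpos hgood hsumle hη0 hη hcum
      rw [hlogw] at h1
      have h2 : Λ - (∑ i, Real.log (ubar i)) / n = gap := by
        simp_rw [hgap, fun i => smoothLog_of_le (hgood i)]
      rw [h2] at h1
      have h3 : 0 ≤ w * (κ * (R * gap - R + (1 + η) * Q)) := by positivity
      linarith
    · push Not at hgood
      obtain ⟨i₀, hi₀⟩ := hgood
      -- One agent below `a ≤ u i₀ / 2` gains the extra `1 / 6` in the tangent bound, divided by `n`
      -- in the mean.
      have h1 : 1 / (6 * n) ≤ gap - (1 - ∑ i, ubar i / (n * u i)) := by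
        have h2 : ∑ i, smoothLog a (ubar i)
            ≤ ∑ i, (Real.log (u i) + (ubar i - u i) / u i - if i = i₀ then 1 / 6 else 0) := by
          refine Finset.sum_le_sum fun i _ => ?_
          split_ifs with hi
          · rw [hi]; exact smoothLog_le_tangent_sub ha (h2a i₀) hi₀
          · rw [sub_zero]; exact htangent i
        rw [Finset.sum_sub_distrib] at h2
        simp only [Finset.sum_ite_eq', Finset.mem_univ, if_true] at h2
        have h3 := div_le_div_of_nonneg_right h2 hn'.le
        rw [sub_div, hsumtan] at h3
        have h4 : (1 / 6 : ℝ) / n = 1 / (6 * n) := by field_simp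
        linarith
      have h5 : ∑ i, ubar i / (n * u i) ≤ h / (2 * l) := by
        calc _ ≤ ∑ i, ubar i / (2 * l) := by
              refine Finset.sum_le_sum fun i _ => ?_
              refine div_le_div_of_nonneg_left (hmem i).1 (by positivity) ?_
              have := hu i
              rw [div_le_iff₀ hn'] at this
              linarith
          _ = (∑ i, ubar i) / (2 * l) := by rw [Finset.sum_div]
          _ ≤ _ := by gcongr
      have h6 : R * (1 / (6 * n)) ≤ R * gap - R + (1 + η) * Q := by
        have := mul_le_mul_of_nonneg_left h1 hR'.le
        linarith
      -- This fixes `κ`: the slack has to pay the full loss `R` and also offset a negative `R *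
      -- gap`, which is at least `-R * h / (2 * l)`.
      have h7 : R * (1 + h / (2 * l)) ≤ κ * (R * gap - R + (1 + η) * Q) := by
        refine le_trans (le_of_eq ?_) (mul_le_mul_of_nonneg_left h6 hκ0)
        rw [hκ]; field_simp
      have h8 : -(R * (h / (2 * l))) ≤ R * gap := by
        have : -(h / (2 * l)) ≤ gap := by linarith
        have := mul_le_mul_of_nonneg_left this hR'.le
        linarith
      have h9 : w * R ≤ w * (R * gap + κ * (R * gap - R + (1 + η) * Q)) :=
        mul_le_mul_of_nonneg_left (by linarith) hwpos.le
      have h10 : 0 ≤ R * η * (h / n)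
          + h / n * (2 / a) * ∑ i, |cumNoise win noise (T₀ + R) i| := by positivity
      linarith
  refine hmain.trans (add_le_add le_rfl (mul_le_mul_of_nonneg_left ?_ hwpos.le))
  have := mul_le_mul_of_nonneg_left hgap_le (show 0 ≤ 1 + κ by linarith)
  linarith

/-! ### The expected regret -/

theorem abs_cumUtility_le {v : Fin n → Fin m → ℝ} {d : ℝ} (hv : ∀ i j, |v i j| ≤ d)
    (item : ℕ → Fin m) (win : ℕ → Fin n) (noise : ℕ → ℝ) (T : ℕ) (i : Fin n) :
    |cumUtility v item win noise T i| ≤ T * d + |cumNoise win noise T i| := by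
  rw [cumUtility_eq]
  refine (abs_add_le _ _).trans (add_le_add_left ?_ _)
  refine (Finset.abs_sum_le_sum_abs _ _).trans ?_
  calc _ ≤ ∑ t ∈ Finset.range T, d := by
        refine Finset.sum_le_sum fun t _ => ?_
        split_ifs
        · exact hv _ _
        · rw [abs_zero]; exact (abs_nonneg _).trans (hv i (item t))
    _ = T * d := by simp

theorem measurableSet_forall_abs_sub_le {Ω : Type*} {m' : MeasurableSpace Ω}
    {f : Ω → Fin n → Fin m → ℝ} (hf : ∀ i j, Measurable fun ω => f ω i j) (v : Fin n → Fin m → ℝ)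
    (ε : ℝ) : MeasurableSet {ω | ∀ i j, |f ω i j - v i j| ≤ ε} := by
  simp only [Set.ofPred_forall]
  exact MeasurableSet.iInter fun i => MeasurableSet.iInter fun j =>
    measurableSet_le ((hf i j).sub_const _).abs measurable_const

theorem measurable_indicator_one {Ω : Type*} {m' : MeasurableSpace Ω} {G : Set Ω}
    (hG : MeasurableSet G) : Measurable (G.indicator (1 : Ω → ℝ)) :=
  measurable_one.indicator hG

theorem integral_affine {Ω : Type*} {mΩ : MeasurableSpace Ω} {P : Measure Ω}
    [IsProbabilityMeasure P] {f₁ f₂ f₃ f₄ : Ω → ℝ} (h₁ : Integrable f₁ P) (h₂ : Integrable f₂ P)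
    (h₃ : Integrable f₃ P) (h₄ : Integrable f₄ P) (c₀ c₁ c₂ c₃ c₄ : ℝ) :
    Integrable (fun ω => c₀ + c₁ * f₁ ω + c₂ * f₂ ω + c₃ * f₃ ω + c₄ * f₄ ω) P ∧
      ∫ ω, (c₀ + c₁ * f₁ ω + c₂ * f₂ ω + c₃ * f₃ ω + c₄ * f₄ ω) ∂P
        = c₀ + c₁ * (∫ ω, f₁ ω ∂P) + c₂ * (∫ ω, f₂ ω ∂P) + c₃ * (∫ ω, f₃ ω ∂P)
          + c₄ * ∫ ω, f₄ ω ∂P := by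
  have i₁ : Integrable (fun ω => c₀ + c₁ * f₁ ω) P := (integrable_const _).add (h₁.const_mul _)
  have i₂ : Integrable (fun ω => c₀ + c₁ * f₁ ω + c₂ * f₂ ω) P := i₁.add (h₂.const_mul _)
  have i₃ : Integrable (fun ω => c₀ + c₁ * f₁ ω + c₂ * f₂ ω + c₃ * f₃ ω) P :=
    i₂.add (h₃.const_mul _)
  refine ⟨i₃.add (h₄.const_mul _), ?_⟩
  rw [integral_add i₃ (h₄.const_mul _), integral_add i₂ (h₃.const_mul _),
    integral_add i₁ (h₂.const_mul _), integral_add (integrable_const _) (h₁.const_mul _),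
    integral_const_mul, integral_const_mul, integral_const_mul, integral_const_mul]
  simp

namespace IsDAEtCRun

variable {l h δ₀ σ : ℝ} {B : Fin n → ℝ} {s : Fin m → ℝ} {v : Fin n → Fin m → ℝ} {T₀ T : ℕ}
  {Ω : Type*} {mΩ : MeasurableSpace Ω} {P : Measure Ω} {H : Filtration ℕ mΩ}
  {item : ℕ → Ω → Fin m} {win : ℕ → Ω → Fin n} {noise : ℕ → Ω → ℝ}

/-- The geometric mean is dominated by the arithmetic mean of the absolute utilities, which has a
finite expectation. -/
theorem integrable_runRegret (hrun : IsDAEtCRun l h δ₀ σ B s v T₀ T P H item win noise)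
    [IsProbabilityMeasure P] (hn : 0 < n) (hT : 0 < T) (hB : ∀ i, B i = 1 / n) {d : ℝ}
    (hv : ∀ i j, |v i j| ≤ d) : Integrable (runRegret B s v item win noise T) P := by
  have hn' : (0 : ℝ) < n := by exact_mod_cast hn
  unfold runRegret regret
  refine (integrable_const _).sub ?_
  have hUm : ∀ i, Measurable fun ω =>
      cumUtility v (fun t => item t ω) (fun t => win t ω) (fun t => noise t ω) T i := fun i =>
    (hrun.measurable_sum le_rfl (f := fun i' j x => if i' = i then v i' j + x else 0)
      (fun i' j => by split_ifs <;> fun_prop)).mono (H.le T) le_rfl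
  have hbound : Integrable (fun ω => (∑ i : Fin n, (T * d
      + |cumNoise (fun t => win t ω) (fun t => noise t ω) T i|)) / n) P :=
    (integrable_finsetSum _ fun i _ =>
      (integrable_const _).add (hrun.integral_abs_noise_le hT i).1).div_const _
  refine hbound.mono' ?_ (ae_of_all _ fun ω => ?_)
  · unfold NSW
    refine Measurable.aestronglyMeasurable ?_
    refine Finset.measurable_prod _ fun i _ => ?_
    exact ((hUm i).max measurable_const).pow_const _
  · unfold NSW
    rw [Real.norm_of_nonneg (Finset.prod_nonneg fun i _ => Real.rpow_nonneg (le_max_right _ _) _)]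
    simp_rw [hB]
    refine (geomMean_le hn fun i => le_max_right _ _).trans ?_
    gcongr with i
    have h1 := abs_cumUtility_le hv (fun t => item t ω) (fun t => win t ω) (fun t => noise t ω) T i
    exact max_le ((le_abs_self _).trans h1) ((abs_nonneg _).trans h1)

theorem integrable_mul_item (hrun : IsDAEtCRun l h δ₀ σ B s v T₀ T P H item win noise)
    [IsProbabilityMeasure P] {t : ℕ} (ht : t < T) {f : Ω → ℝ} {c : ℝ}
    (hf : Measurable[H t] f) (hfc : ∀ ω, |f ω| ≤ c) (q : Fin m → ℝ) :
    Integrable (fun ω => f ω * q (item t ω)) P := by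
  have h1 : Measurable fun ω => f ω * q (item t ω) := (hf.mono (H.le t) le_rfl).mul
    ((measurable_of_finite q).comp ((hrun.item_measurable t ht).mono (H.le _) le_rfl))
  refine Integrable.of_bound h1.aestronglyMeasurable (c * ∑ j, |q j|) (ae_of_all _ fun ω => ?_)
  rw [Real.norm_eq_abs, abs_mul]
  exact mul_le_mul (hfc ω) (Finset.single_le_sum (f := fun j => |q j|) (fun j _ => abs_nonneg _)
    (Finset.mem_univ _)) (abs_nonneg _) ((abs_nonneg _).trans (hfc ω))

/-- With equal weights all agents share the floor `1 / n * l / (1 + δ₀)`, and the common factor `1 /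
n` of the multipliers cancels. -/
theorem bid_div_max_le {vhat : Fin n → Fin m → ℝ} (hn : 0 < n) (hl : 0 < l) (hlh : l ≤ h)
    (hδ : 0 < δ₀) (hB : ∀ i, B i = 1 / n) {ubar : Fin n → ℝ} (hu : ∀ i, ubar i ∈ Set.Icc 0 h)
    {i k : Fin n} {j : Fin m}
    (hbid : multiplier l h δ₀ (B k) (ubar k) * vhat k j
      ≤ multiplier l h δ₀ (B i) (ubar i) * vhat i j) :
    vhat k j / max (ubar k) (1 / n * l / (1 + δ₀))
      ≤ vhat i j / max (ubar i) (1 / n * l / (1 + δ₀)) := by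
  have hn' : (1 : ℝ) ≤ n := by exact_mod_cast hn
  have hb : (0 : ℝ) < 1 / n := by positivity
  have hb1 : (1 : ℝ) / n ≤ 1 := by rw [div_le_one (by linarith)]; exact hn'
  have hcomm : ∀ y z : ℝ, 1 / n / y * z = 1 / n * (z / y) := fun y z => by ring
  rw [hB, hB, multiplier_eq hl hlh hδ hb hb1 (hu k).1 (hu k).2,
    multiplier_eq hl hlh hδ hb hb1 (hu i).1 (hu i).2, hcomm, hcomm] at hbid
  exact le_of_mul_le_mul_left hbid hb

set_option maxHeartbeats 1000000 in
/-- The expected regret, with `η` the relative error of the estimates. -/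
theorem integral_runRegret_le (hrun : IsDAEtCRun l h δ₀ σ B s v T₀ T P H item win noise)
    [IsProbabilityMeasure P] (hn : 0 < n) (hm : 0 < m) (hl : 0 < l) (hδ : 0 < δ₀) (hT₀ : 0 < T₀)
    (hT : T₀ ≤ T) (hB : ∀ i, B i = 1 / n) (hs : ∀ j, s j = 1 / m)
    (hv : ∀ i j, 2 * l ≤ v i j ∧ v i j ≤ h / 2) {η κ a : ℝ}
    (hη : η = Real.sqrt (8 * max 1 (σ ^ 2) * (n * m) * Real.log (n * m * T) / T₀) / (2 * l))
    (hε : Real.sqrt (8 * max 1 (σ ^ 2) * (n * m) * Real.log (n * m * T) / T₀)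
      ≤ min 1 (2 * l) / 2)
    (hκ : κ = 6 * n * (1 + h / (2 * l))) (ha : a = 1 / n * l / (1 + δ₀)) :
    ∫ ω, runRegret B s v item win noise T ω ∂P
      ≤ T₀ * (h / 2 / n) + T * η * (h / n)
        + h / n * (2 / a) * (n * (2 * Real.exp (σ ^ 2 / 2) * Real.sqrt T))
        + 3 * (h / 2 / n)
        + h / 2 / n * ((1 + κ) * (2 * η * T + (h / a) ^ 2 * (1 + Real.log T)) + κ * (η * T)) := by
  obtain ⟨R, rfl⟩ := Nat.exists_eq_add_of_le hT
  have hn' : (0 : ℝ) < n := by exact_mod_cast hn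
  have hm' : (0 : ℝ) < m := by exact_mod_cast hm
  have hTpos : 0 < T₀ + R := by omega
  have hTpos' : (0 : ℝ) < (T₀ + R : ℕ) := by exact_mod_cast hTpos
  have hh4 : 4 * l ≤ h := by have := hv ⟨0, hn⟩ ⟨0, hm⟩; linarith
  have hh : 0 ≤ h := by linarith
  have hlh : l ≤ h := by linarith
  set ε := Real.sqrt (8 * max 1 (σ ^ 2) * (n * m) * Real.log (n * m * (T₀ + R : ℕ)) / T₀) with hεd
  have hε0 : 0 ≤ ε := Real.sqrt_nonneg _
  have hε1 : ε ≤ 1 / 2 := hε.trans (by linarith [min_le_left 1 (2 * l)])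
  have hεl : ε ≤ l := hε.trans (by linarith [min_le_right 1 (2 * l)])
  have hη0 : 0 ≤ η := by rw [hη]; positivity
  have hεη : ε = 2 * l * η := by rw [hη]; field_simp
  have hη1 : η ≤ 1 / 2 := by nlinarith
  have hapos : 0 < a := by rw [ha]; positivity
  have hal : a ≤ l / n := by
    rw [ha, div_le_iff₀ (by positivity)]
    have : 0 ≤ l / n * δ₀ := by positivity
    have e : 1 / (n : ℝ) * l = l / n := by ring
    rw [e]; linarith
  have hκ0 : 0 ≤ κ := by rw [hκ]; positivity
  have hvpos : ∀ i j, 0 ≤ v i j := fun i j => by linarith [(hv i j).1]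
  obtain ⟨x, u, p, hx, hux, hu, hONSW, hwd, hp, hpsum⟩ :=
    exists_equilibrium hn hm (show 0 < 2 * l by positivity) hv
  obtain rfl : B = fun _ => (1 / n : ℝ) := funext hB
  obtain rfl : s = fun _ => (1 / m : ℝ) := funext hs
  set w := ∏ i, (u i) ^ (1 / n : ℝ) with hw
  have hupos : ∀ i, 0 < u i := fun i => lt_of_lt_of_le (by positivity) (hu i)
  have hw0 : 0 ≤ w := Finset.prod_nonneg fun i _ => Real.rpow_nonneg (hupos i).le _
  set vhat : Ω → Fin n → Fin m → ℝ := fun ω =>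
    estimator v (fun τ => item τ ω) (fun τ => win τ ω) (fun τ => noise τ ω) T₀ with hvhat
  set ubar : ℕ → Fin n → Ω → ℝ := fun r i ω =>
    daMean (vhat ω) (fun r => item (T₀ + r) ω) (fun r => win (T₀ + r) ω) r i with hubar
  set N : Fin n → Ω → ℝ := fun i ω =>
    cumNoise (fun t => win t ω) (fun t => noise t ω) (T₀ + R) i with hN
  set G : Set Ω := {ω | ∀ i j, |vhat ω i j - v i j| ≤ ε} with hG
  have hGm : MeasurableSet[H T₀] G :=
    measurableSet_forall_abs_sub_le (hrun.measurable_estimator hT) v ε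
  have hGm' : MeasurableSet G := H.le _ _ hGm
  -- Accuracy is decided by time `T₀`. Multiplying by its indicator, instead of conditioning on it,
  -- keeps the coefficients known to the past.
  set g : Ω → ℝ := G.indicator 1 with hg
  have hgm : Measurable[H T₀] g := measurable_indicator_one hGm
  have hg01 : ∀ ω, 0 ≤ g ω ∧ g ω ≤ 1 := fun ω => by
    by_cases hω : ω ∈ G <;> simp [hg, hω]
  have hgint : Integrable g P := (integrable_const (1 : ℝ)).indicator hGm'
  have hgP : ∫ ω, g ω ∂P = P.real G := integral_indicator_one hGm'
  have hPG : 1 - 3 / ((T₀ + R : ℕ) : ℝ) ≤ P.real G := by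
    have h1 := hrun.measure_estimator_error_le (fun _ => rfl) hn hm hT₀ hT hεd hε1
    have h2 : P.real Gᶜ = 1 - P.real G := probReal_compl_eq_one_sub hGm'
    have h3 : P.real Gᶜ ≤ 3 / ((T₀ + R : ℕ) : ℝ) := h1
    linarith
  -- the comparison terms
  set f : ℕ → Fin n → Ω → ℝ := fun r i ω => g ω * (max (ubar r i ω) a)⁻¹ with hf
  have hfm : ∀ r, r < R → ∀ i, Measurable[H (T₀ + r)] (f r i) := fun r hr i =>
    (hgm.mono (H.mono (by omega)) le_rfl).mul
      ((hrun.measurable_daMean hT (by omega) i).max measurable_const).inv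
  have hfb : ∀ r i ω, |f r i ω| ≤ a⁻¹ := fun r i ω => by
    have h1 : (max (ubar r i ω) a)⁻¹ ≤ a⁻¹ := inv_anti₀ hapos (le_max_right _ _)
    have h2 : 0 ≤ (max (ubar r i ω) a)⁻¹ := inv_nonneg.2 (hapos.le.trans (le_max_right _ _))
    rw [hf, abs_of_nonneg (mul_nonneg (hg01 ω).1 h2)]
    exact (mul_le_of_le_one_left h2 (hg01 ω).2).trans h1
  set D : Ω → ℝ := fun ω => ∑ r ∈ Finset.range R, ∑ i,
    f r i ω * (v i (item (T₀ + r) ω) * x i (item (T₀ + r) ω) - u i) with hD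
  have hDterm : ∀ r ∈ Finset.range R, ∀ i, Integrable (fun ω =>
      f r i ω * (v i (item (T₀ + r) ω) * x i (item (T₀ + r) ω) - u i)) P := fun r hr i =>
    hrun.integrable_mul_item (by rw [Finset.mem_range] at hr; omega)
      (hfm r (Finset.mem_range.1 hr) i) (hfb r i) (fun j => v i j * x i j - u i)
  have hDint : Integrable D P := integrable_finsetSum _ fun r hr =>
    integrable_finsetSum _ fun i _ => hDterm r hr i
  -- Each coefficient is independent of the type it multiplies, and `u i` is the mean of `v i j * x
  -- i j` over the types.
  have hD0 : ∫ ω, D ω ∂P = 0 := by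
    rw [hD, integral_finsetSum _ fun r hr => integrable_finsetSum _ fun i _ => hDterm r hr i]
    refine Finset.sum_eq_zero fun r hr => ?_
    rw [integral_finsetSum _ fun i _ => hDterm r hr i]
    refine Finset.sum_eq_zero fun i _ => ?_
    rw [Finset.mem_range] at hr
    rw [hrun.integral_mul_item (fun _ => rfl) (by omega) (hfm r hr i)
      (fun j => v i j * x i j - u i)]
    have h1 : ∑ j : Fin m, 1 / (m : ℝ) * (v i j * x i j - u i) = 0 := by
      simp_rw [mul_sub]
      rw [Finset.sum_sub_distrib, ← hux]
      simp only [Finset.sum_const, Finset.card_univ, Fintype.card_fin, nsmul_eq_mul]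
      field_simp
      ring
    rw [h1, mul_zero]
  set Q : Ω → ℝ := fun ω => ∑ r ∈ Finset.range R, g ω * p (item (T₀ + r) ω) with hQ
  have hgH : ∀ r, Measurable[H (T₀ + r)] g := fun r => hgm.mono (H.mono (by omega)) le_rfl
  have hQterm : ∀ r ∈ Finset.range R, Integrable (fun ω => g ω * p (item (T₀ + r) ω)) P :=
    fun r hr => hrun.integrable_mul_item (by rw [Finset.mem_range] at hr; omega) (hgH r) (c := 1)
      (fun ω => by rw [abs_of_nonneg (hg01 ω).1]; exact (hg01 ω).2) p
  have hQint : Integrable Q P := integrable_finsetSum _ hQterm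
  have hQle : ∫ ω, Q ω ∂P ≤ R * P.real G := by
    rw [hQ, integral_finsetSum _ hQterm]
    calc _ ≤ ∑ r ∈ Finset.range R, P.real G := by
          refine Finset.sum_le_sum fun r hr => ?_
          rw [Finset.mem_range] at hr
          rw [hrun.integral_mul_item (fun _ => rfl) (by omega) (hgH r) p, hgP]
          exact mul_le_of_le_one_right measureReal_nonneg hpsum
      _ = R * P.real G := by simp
  have hNint : ∀ i, Integrable (fun ω => |N i ω|) P := fun i =>
    (hrun.integral_abs_noise_le hTpos i).1
  have hNle : ∑ i, ∫ ω, |N i ω| ∂P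
      ≤ n * (2 * Real.exp (σ ^ 2 / 2) * Real.sqrt (T₀ + R : ℕ)) := by
    calc _ ≤ ∑ i : Fin n, 2 * Real.exp (σ ^ 2 / 2) * Real.sqrt (T₀ + R : ℕ) :=
          Finset.sum_le_sum fun i _ => (hrun.integral_abs_noise_le hTpos i).2
      _ = _ := by simp
  set C := 2 * η * R + (h / a) ^ 2 * (1 + Real.log R) with hC
  -- One bound for all paths: where `g = 1` it is the bound for accurate estimates, and where `g =
  -- 0` it charges the entire optimum of the `R` remaining rounds.
  set F : Ω → ℝ := fun ω => (T₀ * w + R * η * (h / n)) + h / n * (2 / a) * ∑ i, |N i ω|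
    + R * w * (1 - g ω) + w * ((1 + κ) * (C * g ω - (1 - η) / n * D ω)
      + κ * ((1 + η) * Q ω - R * g ω)) with hF
  have hpath : ∀ᵐ ω ∂P, runRegret (fun _ => 1 / n) (fun _ => 1 / m) v item win noise (T₀ + R) ω
      ≤ F ω := by
    have hex : ∀ᵐ ω ∂P, ∀ r < R, ∀ k,
        multiplier l h δ₀ (1 / n) (ubar r k ω) * vhat ω k (item (T₀ + r) ω)
          ≤ multiplier l h δ₀ (1 / n) (ubar r (win (T₀ + r) ω) ω)
            * vhat ω (win (T₀ + r) ω) (item (T₀ + r) ω) := by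
      rw [ae_all_iff]
      intro r
      by_cases hr : r < R
      · filter_upwards [hrun.exploit (T₀ + r) (by omega) (by omega)] with ω hω _ k
        have := hω k
        simpa only [Nat.add_sub_cancel_left] using this
      · exact ae_of_all _ fun ω h => absurd h hr
    filter_upwards [hex] with ω hω
    by_cases hωG : ω ∈ G
    · have hg1 : g ω = 1 := by simp [hg, hωG]
      have hacc : ∀ i j, |vhat ω i j - v i j| ≤ 2 * l * η := fun i j => by
        rw [← hεη]; exact hωG i j
      have hlow : ∀ i j, (1 - η) * v i j ≤ vhat ω i j := fun i j => by
        have h1 := (abs_le.1 (hacc i j)).1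
        nlinarith [(hv i j).1]
      have hupp : ∀ i j, vhat ω i j ≤ (1 + η) * v i j := fun i j => by
        have h1 := (abs_le.1 (hacc i j)).2
        nlinarith [(hv i j).1]
      have hmem : ∀ i j, vhat ω i j ∈ Set.Icc 0 h := fun i j => by
        have h1 := abs_le.1 (hωG i j)
        constructor <;> linarith [(hv i j).1, (hv i j).2]
      have key := regret_le_of_accurate hn hl hh hapos hal hvpos hη0 hη1 hmem hlow hupp hx hu hw hp
        hκ (fun t => item t ω) (fun t => win t ω) (fun t => noise t ω) T₀ R (by
          intro r hr k
          rw [ha]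
          exact bid_div_max_le (B := fun _ => 1 / n) hn hl hlh hδ (fun _ => rfl)
            (fun i => daMean_mem_Icc hmem hh _ _ r i) (hω r hr k))
      simp only [runRegret, regret, NSW, hONSW]
      refine key.trans (le_of_eq ?_)
      simp only [hF, hD, hQ, hf, hg1, hC, one_mul, hN, hubar]
      ring
    · have hg0 : g ω = 0 := by simp [hg, hωG]
      have hnsw : 0 ≤ NSW (fun _ => 1 / n) v (fun t => item t ω) (fun t => win t ω)
          (fun t => noise t ω) (T₀ + R) :=
        Finset.prod_nonneg fun i _ => Real.rpow_nonneg (le_max_right _ _) _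
      simp only [runRegret, regret, hONSW]
      have hF' : F ω = T₀ * w + R * η * (h / n) + h / n * (2 / a) * ∑ i, |N i ω| + R * w := by
        simp [hF, hD, hQ, hf, hg0]
      rw [hF']
      have h1 : 0 ≤ R * η * (h / n) + h / n * (2 / a) * ∑ i, |N i ω| := by positivity
      push_cast
      linarith
  have hNs : Integrable (fun ω => ∑ i, |N i ω|) P := integrable_finsetSum _ fun i _ => hNint i
  have hFaff : F = fun ω => (T₀ * w + R * η * (h / n) + R * w) + h / n * (2 / a) * (∑ i, |N i ω|)
      + (w * ((1 + κ) * C - κ * R) - R * w) * g ω + (-(w * (1 + κ) * ((1 - η) / n))) * D ω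
      + w * κ * (1 + η) * Q ω := by
    funext ω
    simp only [hF]
    ring
  obtain ⟨hFint, hFeq⟩ := integral_affine hNs hgint hDint hQint
    (T₀ * w + R * η * (h / n) + R * w) (h / n * (2 / a)) (w * ((1 + κ) * C - κ * R) - R * w)
    (-(w * (1 + κ) * ((1 - η) / n))) (w * κ * (1 + η))
  rw [hgP, hD0, integral_finsetSum _ fun i _ => hNint i] at hFeq
  have hintegrable := hrun.integrable_runRegret hn hTpos (fun _ => rfl) (d := h / 2) (fun i j => by
    rw [abs_of_nonneg (hvpos i j)]; exact (hv i j).2)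
  rw [hFaff] at hpath
  refine (integral_mono_ae hintegrable hFint hpath).trans ?_
  rw [hFeq]
  have hPG1 : P.real G ≤ 1 := measureReal_le_one
  have hPG0 : 0 ≤ P.real G := measureReal_nonneg
  have hRT : (R : ℝ) ≤ (T₀ + R : ℕ) := by exact_mod_cast Nat.le_add_left R T₀
  have hlogR : Real.log R ≤ Real.log (T₀ + R : ℕ) := by
    rcases Nat.eq_zero_or_pos R with h0 | h0
    · rw [h0]; simp only [Nat.cast_zero, Real.log_zero]; exact Real.log_natCast_nonneg _
    · exact Real.log_le_log (by exact_mod_cast h0) hRT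
  have hlogR0 : 0 ≤ Real.log R := Real.log_natCast_nonneg _
  have hC0 : 0 ≤ C := by rw [hC]; positivity
  have hCle : C ≤ 2 * η * (T₀ + R : ℕ) + (h / a) ^ 2 * (1 + Real.log (T₀ + R : ℕ)) := by
    rw [hC]; gcongr
  have e1 : T₀ * w ≤ T₀ * (h / 2 / n) := by gcongr
  have e2 : R * η * (h / n) ≤ (T₀ + R : ℕ) * η * (h / n) := by gcongr
  have e3 : h / n * (2 / a) * ∑ i, ∫ ω, |N i ω| ∂P ≤ h / n * (2 / a)
      * (n * (2 * Real.exp (σ ^ 2 / 2) * Real.sqrt (T₀ + R : ℕ))) := by gcongr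
  have e4 : R * w * (1 - P.real G) ≤ 3 * (h / 2 / n) := by
    calc _ ≤ ((T₀ + R : ℕ) : ℝ) * (h / 2 / n) * (3 / ((T₀ + R : ℕ) : ℝ)) := by
          refine mul_le_mul (by gcongr) (by linarith) (by linarith) (by positivity)
      _ = _ := by field_simp
  have e5 : (1 + κ) * (C * P.real G)
      ≤ (1 + κ) * (2 * η * (T₀ + R : ℕ) + (h / a) ^ 2 * (1 + Real.log (T₀ + R : ℕ))) := by
    refine mul_le_mul_of_nonneg_left ?_ (by linarith)
    exact (mul_le_of_le_one_right hC0 hPG1).trans hCle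
  have e6 : κ * ((1 + η) * (∫ ω, Q ω ∂P) - R * P.real G) ≤ κ * (η * (T₀ + R : ℕ)) := by
    refine mul_le_mul_of_nonneg_left ?_ hκ0
    have h1 := mul_le_mul_of_nonneg_left hQle (show 0 ≤ 1 + η by linarith)
    have h2 : η * (R * P.real G) ≤ η * (T₀ + R : ℕ) :=
      mul_le_mul_of_nonneg_left ((mul_le_of_le_one_right (by positivity) hPG1).trans hRT) hη0
    linarith
  have hlogT : 0 ≤ Real.log (T₀ + R : ℕ) := Real.log_natCast_nonneg _
  have e7 : w * ((1 + κ) * (C * P.real G) + κ * ((1 + η) * (∫ ω, Q ω ∂P) - R * P.real G))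
      ≤ h / 2 / n * ((1 + κ) * (2 * η * (T₀ + R : ℕ)
        + (h / a) ^ 2 * (1 + Real.log (T₀ + R : ℕ))) + κ * (η * (T₀ + R : ℕ))) := by
    refine (mul_le_mul_of_nonneg_left (add_le_add e5 e6) hw0).trans ?_
    refine mul_le_mul_of_nonneg_right hwd ?_
    have : 0 ≤ 1 + κ := by linarith
    positivity
  linarith

end IsDAEtCRun

/-! ### The three terms of the bound -/

/-- The constant of the regret bound, which depends only on the range of the values and on the
noise. -/
def regretConst (l h σ : ℝ) : ℝ :=
  2 * h + (h + 21 / 2 * h * (1 + h / (2 * l))) * (2 * Real.sqrt (max 1 (σ ^ 2)) / l)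
    + (4 * h * Real.exp (σ ^ 2 / 2) / l + 7 / 2 * h * (1 + h / (2 * l)) * (h / l) ^ 2)
      * (l ^ 2 / h ^ 4)

theorem iInf_one_div (hn : 0 < n) {B : Fin n → ℝ} (hB : ∀ i, B i = 1 / n) :
    ⨅ i, B i = 1 / n := by
  have : Nonempty (Fin n) := ⟨⟨0, hn⟩⟩
  simp_rw [hB]
  exact ciInf_const

/-- Since `a⁻¹ = n * (1 + δ₀) / l`, the remaining terms involve only the first two powers of `n * (1
+ δ₀)`. The summand with `h ^ 4` alone in the constant dominates them, using `w ≥ l`. -/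
theorem sq_le_mul_constDA (hn : 0 < n) {B : Fin n → ℝ} (hB : ∀ i, B i = 1 / n) {l h δ₀ w : ℝ}
    (hl : 0 < l) (hδ : 0 < δ₀) (hw : w ∈ Set.Icc l h) :
    (n * (1 + δ₀)) ^ 2 ≤ l ^ 2 / h ^ 4 * (n * constDA B l h δ₀ w) := by
  have hn' : (1 : ℝ) ≤ n := by exact_mod_cast hn
  have hh : 0 < h := by linarith [hw.1, hw.2]
  have hwpos : 0 < w := by linarith [hw.1]
  have hC : l ^ 2 * (1 + δ₀) ^ 6 * n ^ 4 / l ^ 4 * h ^ 4 ≤ constDA B l h δ₀ w := by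
    rw [constDA, iInf_one_div hn hB]
    have e : w ^ 2 * (1 + δ₀) ^ 6 / (l ^ 4 * (1 / (n : ℝ)) ^ 4)
        = w ^ 2 * (1 + δ₀) ^ 6 * n ^ 4 / l ^ 4 := by field_simp
    rw [e]
    have h1 : l ≤ w := hw.1
    have h2 : 0 ≤ h ^ 3 * w ^ 2 / l * (1 / δ₀) ^ 2 := by positivity
    refine mul_le_mul ?_ (by linarith) (by positivity) (by positivity)
    gcongr
  calc (n * (1 + δ₀)) ^ 2 ≤ (n : ℝ) ^ 5 * (1 + δ₀) ^ 6 := by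
        rw [mul_pow]
        refine mul_le_mul (pow_le_pow_right₀ hn' (by norm_num))
          (pow_le_pow_right₀ (by linarith) (by norm_num)) (by positivity) (by positivity)
    _ = l ^ 2 / h ^ 4 * (n * (l ^ 2 * (1 + δ₀) ^ 6 * n ^ 4 / l ^ 4 * h ^ 4)) := by field_simp
    _ ≤ _ := by gcongr

theorem constDA_nonneg {B : Fin n → ℝ} {l h δ₀ w : ℝ} (hl : 0 < l) (hδ : 0 < δ₀)
    (hw : w ∈ Set.Icc l h) : 0 ≤ constDA B l h δ₀ w := by
  have hh : 0 < h := by linarith [hw.1, hw.2]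
  unfold constDA
  have h1 : 0 ≤ (⨅ i, B i) ^ 4 := by positivity
  positivity

/-- The accuracy of the estimates, in terms of `√(nm / T₀)`. -/
theorem sqrt_log_le {M : ℝ} (hn : 0 < n) (hm : 0 < m) {T₀ T : ℕ} (hT₀ : 0 < T₀) (hT : T₀ ≤ T)
    (hM : 1 ≤ M) (hε : Real.sqrt (8 * M * (n * m) * Real.log (n * m * T) / T₀) ≤ 1 / 2) :
    Real.sqrt (8 * M * (n * m) * Real.log (n * m * T) / T₀)
      ≤ 4 * Real.sqrt M * (1 + Real.log T) * Real.sqrt (n * m / T₀) := by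
  have hT₀' : (0 : ℝ) < T₀ := by exact_mod_cast hT₀
  have hTT : (T₀ : ℝ) ≤ T := by exact_mod_cast hT
  have hT1 : (1 : ℝ) ≤ T := by exact_mod_cast (hT₀.trans_le hT)
  have hnm1 : 1 ≤ n * m := Nat.mul_pos hn hm
  have hnm : (1 : ℝ) ≤ n * m := by exact_mod_cast hnm1
  have hlogT : 0 ≤ Real.log T := Real.log_nonneg hT1
  -- If `n * m ≥ 2` the logarithm is at least `1 / 2`, so the accuracy hypothesis forces `T₀`, hence
  -- `T`, above `n * m`. Thus `log (n * m * T)` is at most `2 * log T`, and no logarithm of `n * m`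
  -- survives.
  have hnmT : (n * m : ℝ) ≤ T := by
    rcases hnm1.eq_or_lt with h1 | h2
    · have : (n * m : ℝ) = 1 := by exact_mod_cast h1.symm
      rw [this]; exact hT1
    · have h2' : (2 : ℝ) ≤ n * m := by exact_mod_cast h2
      have h3 : (1 : ℝ) / 2 ≤ Real.log (n * m * T) := by
        have h4 : Real.log 2 ≤ Real.log (n * m * T) :=
          Real.log_le_log (by norm_num) (by nlinarith)
        linarith [Real.log_two_gt_d9]
      rw [Real.sqrt_le_left (by norm_num), div_le_iff₀ hT₀'] at hε
      have h5 : 8 * 1 * (n * m) * (1 / 2 : ℝ) ≤ 8 * M * (n * m) * Real.log (n * m * T) := by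
        gcongr
      linarith
  -- Squared on purpose, so that the square root produces a single factor `1 + log T`.
  have hlog : Real.log (n * m * T) ≤ 2 * (1 + Real.log T) ^ 2 := by
    rw [Real.log_mul (by positivity) (by positivity)]
    have := Real.log_le_log (by positivity) hnmT
    nlinarith
  have hrhs : 4 * Real.sqrt M * (1 + Real.log T) * Real.sqrt (n * m / T₀)
      = Real.sqrt (16 * M * (1 + Real.log T) ^ 2 * (n * m / T₀)) := by
    have h4 : (16 : ℝ) = 4 ^ 2 := by norm_num
    rw [Real.sqrt_mul (by positivity), Real.sqrt_mul (by positivity),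
      Real.sqrt_mul (by positivity), Real.sqrt_sq (by linarith), h4, Real.sqrt_sq (by norm_num)]
  rw [hrhs]
  refine Real.sqrt_le_sqrt ?_
  have h1 : 8 * M * (n * m) * Real.log (n * m * T) / T₀
      = 8 * M * (n * m / T₀) * Real.log (n * m * T) := by ring
  rw [h1]
  calc _ ≤ 8 * M * (n * m / T₀) * (2 * (1 + Real.log T) ^ 2) := by gcongr
    _ = _ := by ring

set_option maxHeartbeats 1000000 in
/-- The regret bound for a general exploration length. -/
theorem IsDAEtCRun.integral_runRegret_le_regretConst {l h δ₀ σ : ℝ} {B : Fin n → ℝ} {s : Fin m → ℝ}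
    {v : Fin n → Fin m → ℝ} {T₀ T : ℕ} {Ω : Type*} {mΩ : MeasurableSpace Ω} {P : Measure Ω}
    {H : Filtration ℕ mΩ} {item : ℕ → Ω → Fin m} {win : ℕ → Ω → Fin n} {noise : ℕ → Ω → ℝ}
    (hrun : IsDAEtCRun l h δ₀ σ B s v T₀ T P H item win noise)
    [IsProbabilityMeasure P] (hn : 0 < n) (hm : 0 < m) (hl : 0 < l) (hδ : 0 < δ₀) (hT₀ : 0 < T₀)
    (hT : T₀ ≤ T) (hB : ∀ i, B i = 1 / n) (hs : ∀ j, s j = 1 / m)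
    (hv : ∀ i j, 2 * l ≤ v i j ∧ v i j ≤ h / 2)
    (hε : Real.sqrt (8 * max 1 (σ ^ 2) * (n * m) * Real.log (n * m * T) / T₀)
      ≤ min 1 (2 * l) / 2) {w : ℝ} (hw : w ∈ Set.Icc l h) :
    ∫ ω, runRegret B s v item win noise T ω ∂P
      ≤ regretConst l h σ * (1 + Real.log T)
        * (T₀ + Real.sqrt (n * m / T₀) * T + n * constDA B l h δ₀ w * Real.sqrt T) := by
  have hn' : (1 : ℝ) ≤ n := by exact_mod_cast hn
  have hT₀' : (1 : ℝ) ≤ T₀ := by exact_mod_cast hT₀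
  have hT1 : (1 : ℝ) ≤ T := by exact_mod_cast (hT₀.trans_le hT)
  have hh : 0 < h := by linarith [hw.1, hw.2]
  have hmain := hrun.integral_runRegret_le hn hm hl hδ hT₀ hT hB hs hv rfl hε rfl rfl
  have hacc := sqrt_log_le hn hm hT₀ hT (le_max_left 1 (σ ^ 2))
    (hε.trans (by linarith [min_le_left 1 (2 * l)]))
  set ε := Real.sqrt (8 * max 1 (σ ^ 2) * (n * m) * Real.log (n * m * T) / T₀) with hεd
  have hε0 : 0 ≤ ε := Real.sqrt_nonneg _
  set M := Real.sqrt (max 1 (σ ^ 2)) with hM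
  set L := 1 + Real.log T with hL
  have hL1 : 1 ≤ L := by linarith [Real.log_nonneg hT1]
  set X := Real.sqrt (n * m / T₀) * T with hX
  have hX0 : 0 ≤ X := by positivity
  set Y := n * constDA B l h δ₀ w * Real.sqrt T with hY
  have hC0 : 0 ≤ constDA B l h δ₀ w := constDA_nonneg hl hδ hw
  have hsq1 : 1 ≤ Real.sqrt T := Real.one_le_sqrt.2 hT1
  set c := 1 + h / (2 * l) with hc
  have hc1 : 1 ≤ c := by
    have : 0 ≤ h / (2 * l) := by positivity
    linarith
  set E := Real.exp (σ ^ 2 / 2) with hE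
  have hsqC := sq_le_mul_constDA hn hB hl hδ hw
  have hY1 : (n * (1 + δ₀)) ^ 2 * Real.sqrt T ≤ l ^ 2 / h ^ 4 * Y := by
    rw [hY, ← mul_assoc]
    exact mul_le_mul_of_nonneg_right hsqC (Real.sqrt_nonneg _)
  have hY2 : (n * (1 + δ₀)) ^ 2 ≤ l ^ 2 / h ^ 4 * Y :=
    (le_mul_of_one_le_right (by positivity) hsq1).trans hY1
  have hY3 : n * (1 + δ₀) * Real.sqrt T ≤ l ^ 2 / h ^ 4 * Y := by
    refine le_trans (mul_le_mul_of_nonneg_right ?_ (Real.sqrt_nonneg _)) hY1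
    exact le_self_pow₀ (by nlinarith) (by norm_num)
  have hηT : ε / (2 * l) * T ≤ 2 * M / l * (L * X) := by
    calc _ ≤ 4 * M * L * Real.sqrt (n * m / T₀) / (2 * l) * T := by gcongr
      _ = _ := by rw [hX]; field_simp; ring
  set η := ε / (2 * l) with hη
  have hη0 : 0 ≤ η := by positivity
  have t1 : T₀ * (h / 2 / n) ≤ h / 2 * T₀ := by
    rw [mul_comm]
    exact mul_le_mul_of_nonneg_right (div_le_self (by positivity) hn') (by positivity)
  have t2 : T * η * (h / n) ≤ h * (η * T) := by
    calc _ ≤ T * η * h := by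
          exact mul_le_mul_of_nonneg_left (div_le_self hh.le hn') (by positivity)
      _ = _ := by ring
  have t3 : h / n * (2 / (1 / n * l / (1 + δ₀))) * (n * (2 * E * Real.sqrt T))
      = 4 * h * E / l * (n * (1 + δ₀) * Real.sqrt T) := by
    field_simp
    ring
  have t4 : 3 * (h / 2 / n) ≤ 3 * h / 2 * T₀ := by
    have h1 : h / 2 / n ≤ h / 2 := div_le_self (by positivity) hn'
    nlinarith
  have hκ1 : 1 + 6 * n * c ≤ 7 * n * c := by nlinarith
  have t5 : h / 2 / n * ((1 + 6 * n * c) * (2 * η * T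
        + (h / (1 / n * l / (1 + δ₀))) ^ 2 * L) + 6 * n * c * (η * T))
      ≤ 7 / 2 * h * c * (3 * (η * T) + (h / l) ^ 2 * (n * (1 + δ₀)) ^ 2 * L) := by
    calc _ ≤ h / 2 / n * (7 * n * c * (2 * η * T
        + (h / (1 / n * l / (1 + δ₀))) ^ 2 * L) + 7 * n * c * (η * T)) := by
          gcongr
          linarith
      _ = _ := by field_simp; ring
  have s1 : h / 2 * T₀ + 3 * h / 2 * T₀ ≤ 2 * h * (L * T₀) := by
    have : (T₀ : ℝ) ≤ L * T₀ := le_mul_of_one_le_left (by linarith) hL1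
    nlinarith
  have s2 : h * (η * T) + 7 / 2 * h * c * (3 * (η * T))
      ≤ (h + 21 / 2 * h * c) * (2 * M / l) * (L * X) := by
    calc _ = (h + 21 / 2 * h * c) * (η * T) := by ring
      _ ≤ (h + 21 / 2 * h * c) * (2 * M / l * (L * X)) :=
          mul_le_mul_of_nonneg_left hηT (by positivity)
      _ = _ := by ring
  have hY0 : 0 ≤ Y := by positivity
  have s3 : 4 * h * E / l * (n * (1 + δ₀) * Real.sqrt T)
      ≤ 4 * h * E / l * (l ^ 2 / h ^ 4) * (L * Y) := by
    calc _ ≤ 4 * h * E / l * (l ^ 2 / h ^ 4 * Y) := by gcongr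
      _ ≤ 4 * h * E / l * (l ^ 2 / h ^ 4 * (L * Y)) := by
          gcongr
          exact le_mul_of_one_le_left hY0 hL1
      _ = _ := by ring
  have s4 : 7 / 2 * h * c * ((h / l) ^ 2 * (n * (1 + δ₀)) ^ 2 * L)
      ≤ 7 / 2 * h * c * (h / l) ^ 2 * (l ^ 2 / h ^ 4) * (L * Y) := by
    calc _ ≤ 7 / 2 * h * c * ((h / l) ^ 2 * (l ^ 2 / h ^ 4 * Y) * L) := by gcongr
      _ = _ := by ring
  -- Expanding the product gives the matching terms needed below and a nonnegative remainder of
  -- mixed terms.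
  have hfin : regretConst l h σ * L * (T₀ + X + Y)
      = 2 * h * (L * T₀) + (h + 21 / 2 * h * c) * (2 * M / l) * (L * X)
        + 4 * h * E / l * (l ^ 2 / h ^ 4) * (L * Y)
        + 7 / 2 * h * c * (h / l) ^ 2 * (l ^ 2 / h ^ 4) * (L * Y)
        + (2 * h * (L * (X + Y))
          + (h + 21 / 2 * h * c) * (2 * M / l) * (L * (T₀ + Y))
          + (4 * h * E / l + 7 / 2 * h * c * (h / l) ^ 2) * (l ^ 2 / h ^ 4) * (L * (T₀ + X))) := by
    rw [regretConst]
    ring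
  rw [hfin]
  have hrest : 0 ≤ 2 * h * (L * (X + Y))
          + (h + 21 / 2 * h * c) * (2 * M / l) * (L * (T₀ + Y))
          + (4 * h * E / l + 7 / 2 * h * c * (h / l) ^ 2) * (l ^ 2 / h ^ 4) * (L * (T₀ + X)) := by
    positivity
  rw [t3] at hmain
  linarith

/-! ### Asymptotics -/

/-- The exponent `1 / 12` is half of `2 / 3 - 1 / 2`: one half absorbs the logarithms, the other the
constants. -/
theorem one_add_log_pow_le (q : ℕ) {x : ℝ} (hx : 1 ≤ x) :
    (1 + Real.log x) ^ q ≤ (1 + 12 * ((q : ℝ) + 1)) ^ q * x ^ (1 / 12 : ℝ) := by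
  have hx0 : 0 ≤ x := by linarith
  set r : ℝ := 1 / (12 * ((q : ℝ) + 1)) with hr
  have hr0 : 0 < r := by positivity
  have h1 : Real.log x ≤ 12 * ((q : ℝ) + 1) * x ^ r := by
    refine (Real.log_le_rpow_div hx0 hr0).trans (le_of_eq ?_)
    rw [hr]; field_simp
  have h2 : 1 ≤ x ^ r := Real.one_le_rpow hx hr0.le
  have h3 : 1 + Real.log x ≤ (1 + 12 * ((q : ℝ) + 1)) * x ^ r := by linarith
  refine (pow_le_pow_left₀ (by linarith [Real.log_nonneg hx]) h3 q).trans ?_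
  rw [mul_pow, ← Real.rpow_natCast (x ^ r), ← Real.rpow_mul hx0]
  refine mul_le_mul_of_nonneg_left (Real.rpow_le_rpow_of_exponent_le hx ?_) (by positivity)
  rw [hr, one_div_mul_eq_div, div_le_div_iff₀ (by positivity) (by norm_num)]
  linarith

theorem rpow_two_thirds_pow_three {x : ℝ} (hx : 0 ≤ x) : (x ^ (2 / 3 : ℝ)) ^ 3 = x ^ 2 := by
  rw [← Real.rpow_natCast, ← Real.rpow_mul hx, ← Real.rpow_natCast x 2]
  norm_num

/-- If `T₀` is at least `T ^ (2 / 3)` the first term suffices. Otherwise `T / √T₀` is at least `T ^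
(2 / 3)`. The bound is uniform in `T₀`. -/
theorem rpow_two_thirds_le (hn : 0 < n) (hm : 0 < m) {T T₀ : ℕ} (hT : 0 < T) (hT₀ : 0 < T₀) :
    (T : ℝ) ^ (2 / 3 : ℝ) ≤ T₀ + Real.sqrt (n * m / T₀) * T := by
  have hT' : (0 : ℝ) < T := by exact_mod_cast hT
  have hT₀' : (0 : ℝ) < T₀ := by exact_mod_cast hT₀
  have hnm : (1 : ℝ) ≤ n * m := by exact_mod_cast Nat.mul_pos hn hm
  set z := (T : ℝ) ^ (2 / 3 : ℝ) with hz
  have hz0 : 0 < z := Real.rpow_pos_of_pos hT' _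
  have hz3 : z ^ 3 = (T : ℝ) ^ 2 := rpow_two_thirds_pow_three hT'.le
  rcases le_total z T₀ with h | h
  · have : 0 ≤ Real.sqrt (n * m / T₀) * T := by positivity
    linarith
  · have h1 : z ≤ Real.sqrt (n * m / T₀) * T := by
      refine le_of_sq_le_sq ?_ (by positivity)
      rw [mul_pow, Real.sq_sqrt (by positivity), ← hz3, div_mul_eq_mul_div, le_div_iff₀ hT₀']
      calc z ^ 2 * T₀ ≤ z ^ 2 * z := by gcongr
        _ = 1 * z ^ 3 := by ring
        _ ≤ _ := by gcongr
    linarith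

/-- The term with the constant of dual averaging is dominated by the two others. -/
theorem eventually_mul_sqrt_le (hn : 0 < n) (hm : 0 < m) {D : ℝ} (hD : 0 ≤ D) (q : ℕ) {ε : ℝ}
    (hε : 0 < ε) : ∀ᶠ T : ℕ in atTop, ∀ T₀ : ℕ, 0 < T₀ →
      (1 + Real.log T) ^ q * (D * Real.sqrt T) ≤ ε * (T₀ + Real.sqrt (n * m / T₀) * T) := by
  have hlim : Tendsto (fun T : ℕ => (T : ℝ) ^ (1 / 12 : ℝ)) atTop atTop :=
    (tendsto_rpow_atTop (by norm_num)).comp tendsto_natCast_atTop_atTop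
  filter_upwards [hlim.eventually_ge_atTop ((1 + 12 * ((q : ℝ) + 1)) ^ q * D / ε),
    eventually_ge_atTop 1] with T hT hT1 T₀ hT₀
  have hT1' : (1 : ℝ) ≤ T := by exact_mod_cast hT1
  have hT0 : (0 : ℝ) < T := by linarith
  rw [div_le_iff₀ hε] at hT
  refine le_trans ?_ (mul_le_mul_of_nonneg_left (rpow_two_thirds_le hn hm hT1 hT₀) hε.le)
  have h1 := one_add_log_pow_le q hT1'
  have h2 : (T : ℝ) ^ (2 / 3 : ℝ)
      = T ^ (1 / 12 : ℝ) * (T ^ (1 / 12 : ℝ) * T ^ (1 / 2 : ℝ)) := by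
    rw [← Real.rpow_add hT0, ← Real.rpow_add hT0]
    norm_num
  rw [h2, Real.sqrt_eq_rpow]
  calc _ ≤ (1 + 12 * ((q : ℝ) + 1)) ^ q * (T : ℝ) ^ (1 / 12 : ℝ) * (D * T ^ (1 / 2 : ℝ)) := by
        gcongr
    _ = (1 + 12 * ((q : ℝ) + 1)) ^ q * D * (T ^ (1 / 12 : ℝ) * T ^ (1 / 2 : ℝ)) := by ring
    _ ≤ T ^ (1 / 12 : ℝ) * ε * (T ^ (1 / 12 : ℝ) * T ^ (1 / 2 : ℝ)) := by gcongr
    _ = _ := by ring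

/-- The exploration length `T ^ (2/3) * (n m) ^ (1/3)` is admissible, and balances the two leading
terms. -/
theorem eventually_explorationLength (hn : 0 < n) (hm : 0 < m) {M τ : ℝ} (hM : 1 ≤ M)
    (hτ : 0 < τ) : ∀ᶠ T : ℕ in atTop, ∀ T₀ : ℕ,
      |(T₀ : ℝ) - (T : ℝ) ^ (2 / 3 : ℝ) * (n * m : ℝ) ^ (1 / 3 : ℝ)| < 1 →
      0 < T₀ ∧ T₀ ≤ T ∧ Real.sqrt (8 * M * (n * m) * Real.log (n * m * T) / T₀) ≤ τ ∧
      T₀ + Real.sqrt (n * m / T₀) * T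
        ≤ 4 * ((T : ℝ) ^ (2 / 3 : ℝ) * (n * m : ℝ) ^ (1 / 3 : ℝ)) := by
  have hnm : (1 : ℝ) ≤ n * m := by exact_mod_cast Nat.mul_pos hn hm
  have hnm0 : (0 : ℝ) < n * m := by linarith
  set y := (n * m : ℝ) with hy
  set b := y ^ (1 / 3 : ℝ) with hb
  have hb1 : 1 ≤ b := Real.one_le_rpow hnm (by norm_num)
  have hb3 : b ^ 3 = y := by
    rw [hb, ← Real.rpow_natCast, ← Real.rpow_mul hnm0.le]; norm_num
  have hyT : Tendsto (fun T : ℕ => y * (T : ℝ)) atTop atTop :=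
    tendsto_natCast_atTop_atTop.const_mul_atTop hnm0
  -- The constant is chosen so that `8 * M * y * log (y * T)` is at most `τ ^ 2` times half the
  -- unrounded exploration length.
  have hlog := hyT.eventually ((isLittleO_log_rpow_atTop (r := 2 / 3) (by norm_num)).bound
    (show 0 < τ ^ 2 / (16 * M * y * b) by positivity))
  have hlim : Tendsto (fun T : ℕ => (T : ℝ) ^ (1 / 3 : ℝ)) atTop atTop :=
    (tendsto_rpow_atTop (by norm_num)).comp tendsto_natCast_atTop_atTop
  -- The second condition yields `T₀ ≤ T`. The third gives `z ≥ 4`, so rounding loses at most half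
  -- of `z * b`.
  filter_upwards [hlog, hlim.eventually_ge_atTop (2 * b), eventually_ge_atTop 8]
    with T h1 h2 h3 T₀ hT₀
  have hT8 : (8 : ℝ) ≤ T := by exact_mod_cast h3
  have hT0 : (0 : ℝ) < T := by linarith
  set z := (T : ℝ) ^ (2 / 3 : ℝ) with hz
  have hz0 : 0 < z := Real.rpow_pos_of_pos hT0 _
  have hz3 : z ^ 3 = (T : ℝ) ^ 2 := rpow_two_thirds_pow_three hT0.le
  have hz4 : 4 ≤ z := by
    by_contra hcon
    push Not at hcon
    have : z ^ 3 < 4 ^ 3 := pow_lt_pow_left₀ hcon hz0.le (by norm_num)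
    nlinarith
  have hS4 : 4 ≤ z * b := by nlinarith
  obtain ⟨h4, h5⟩ := abs_lt.1 hT₀
  have hlow : z * b / 2 ≤ T₀ := by linarith
  have hT₀pos : (0 : ℝ) < T₀ := by linarith
  refine ⟨by exact_mod_cast hT₀pos, ?_, ?_, ?_⟩
  · have h6 : z * (2 * b) ≤ T := by
      calc z * (2 * b) ≤ z * (T : ℝ) ^ (1 / 3 : ℝ) := by gcongr
        _ = T := by
          rw [hz, ← Real.rpow_add hT0]; norm_num
    have : (T₀ : ℝ) ≤ T := by linarith
    exact_mod_cast this
  · rw [Real.norm_of_nonneg (Real.log_nonneg (by nlinarith)),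
      Real.norm_of_nonneg (Real.rpow_nonneg (by positivity) _),
      Real.mul_rpow hnm0.le hT0.le] at h1
    have hyb : y ^ (2 / 3 : ℝ) = b ^ 2 := by
      rw [hb, ← Real.rpow_natCast, ← Real.rpow_mul hnm0.le]; norm_num
    rw [hyb] at h1
    rw [Real.sqrt_le_left hτ.le, div_le_iff₀ hT₀pos]
    calc 8 * M * y * Real.log (y * T)
        ≤ 8 * M * y * (τ ^ 2 / (16 * M * y * b) * (b ^ 2 * z)) := by gcongr
      _ = τ ^ 2 * (z * b / 2) := by field_simp; ring
      _ ≤ _ := by gcongr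
  · have h7 : Real.sqrt (y / T₀) * T ≤ 2 * (z * b) := by
      refine le_of_sq_le_sq ?_ (by positivity)
      rw [mul_pow, Real.sq_sqrt (by positivity), ← hz3, div_mul_eq_mul_div, div_le_iff₀ hT₀pos,
        ← hb3]
      calc b ^ 3 * z ^ 3 = 2 * (z * b) ^ 2 * (z * b / 2) := by ring
        _ ≤ 2 * (z * b) ^ 2 * T₀ := by gcongr
        _ ≤ (2 * (z * b)) ^ 2 * T₀ := by
          gcongr
          nlinarith [sq_nonneg (z * b)]
    linarith

end FairDivision

end

/-! ### The three claims of the theorem -/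

theorem theorem1 :
    ∃ p : ℕ, ∀ l h σ : ℝ, 0 < l → 0 ≤ σ → ∃ K : ℝ, 0 < K ∧
      -- the regret bound for a general exploration length
      (∀ (n m : ℕ), 0 < n → 0 < m → ∀ δ₀ : ℝ, 0 < δ₀ → ∀ T₀ T : ℕ, 0 < T₀ → T₀ ≤ T →
        Real.sqrt (8 * max 1 (σ ^ 2) * (n * m) * Real.log (n * m * T) / T₀)
          ≤ min 1 (2 * l) / 2 →
        ∀ (B : Fin n → ℝ) (s : Fin m → ℝ) (v : Fin n → Fin m → ℝ),
        (∀ i, B i = 1 / n) → (∀ j, s j = 1 / m) →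
        (∀ i j, 2 * l ≤ v i j ∧ v i j ≤ h / 2) →
        ∀ (Ω : Type*) [mΩ : MeasurableSpace Ω] (P : Measure Ω) [IsProbabilityMeasure P]
          (H : Filtration ℕ mΩ) (item : ℕ → Ω → Fin m) (win : ℕ → Ω → Fin n)
          (noise : ℕ → Ω → ℝ),
        FairDivision.IsDAEtCRun l h δ₀ σ B s v T₀ T P H item win noise →
        Integrable (FairDivision.runRegret B s v item win noise T) P ∧
        ∀ w ∈ Set.Icc l h,
          ∫ ω, FairDivision.runRegret B s v item win noise T ω ∂P
            ≤ K * (1 + Real.log T) ^ p *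
              (T₀ + Real.sqrt (n * m / T₀) * T
                + n * FairDivision.constDA B l h δ₀ w * Real.sqrt T)) ∧
      -- the term with the constant of dual averaging is non-leading with respect to `T`
      (∀ (n m : ℕ), 0 < n → 0 < m → ∀ δ₀ : ℝ, 0 < δ₀ →
        ∀ B : Fin n → ℝ, (∀ i, B i = 1 / n) → ∀ w ∈ Set.Icc l h,
        ∀ q : ℕ, ∀ ε : ℝ, 0 < ε → ∀ᶠ T : ℕ in atTop, ∀ T₀ : ℕ, 0 < T₀ →
          (1 + Real.log T) ^ q * (n * FairDivision.constDA B l h δ₀ w * Real.sqrt T)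
            ≤ ε * (T₀ + Real.sqrt (n * m / T₀) * T)) ∧
      -- the bound for exploration length `T ^ (2/3) * (n m) ^ (1/3)`, up to rounding
      (∀ (n m : ℕ), 0 < n → 0 < m → ∀ δ₀ : ℝ, 0 < δ₀ → ∀ᶠ T : ℕ in atTop, ∀ T₀ : ℕ,
        |(T₀ : ℝ) - (T : ℝ) ^ (2 / 3 : ℝ) * (n * m : ℝ) ^ (1 / 3 : ℝ)| < 1 →
        ∀ (B : Fin n → ℝ) (s : Fin m → ℝ) (v : Fin n → Fin m → ℝ),
        (∀ i, B i = 1 / n) → (∀ j, s j = 1 / m) →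
        (∀ i j, 2 * l ≤ v i j ∧ v i j ≤ h / 2) →
        ∀ (Ω : Type*) [mΩ : MeasurableSpace Ω] (P : Measure Ω) [IsProbabilityMeasure P]
          (H : Filtration ℕ mΩ) (item : ℕ → Ω → Fin m) (win : ℕ → Ω → Fin n)
          (noise : ℕ → Ω → ℝ),
        FairDivision.IsDAEtCRun l h δ₀ σ B s v T₀ T P H item win noise →
        Integrable (FairDivision.runRegret B s v item win noise T) P ∧
        ∫ ω, FairDivision.runRegret B s v item win noise T ω ∂P
          ≤ K * (1 + Real.log T) ^ p *
            ((T : ℝ) ^ (2 / 3 : ℝ) * (n * m : ℝ) ^ (1 / 3 : ℝ))) := by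

  -- The constant is fixed before `l ≤ h` is known, so `regretConst` could be negative: hence the
  -- absolute value and the `1`. The `8` is `4` from balancing the leading terms, doubled by the
  -- dual averaging term.
  refine ⟨1, fun l h σ hl hσ => ⟨1 + 8 * |FairDivision.regretConst l h σ|, by positivity, ?_, ?_, ?_⟩⟩
  · intro n m hn hm δ₀ hδ T₀ T hT₀ hT hε B s v hB hs hv Ω _ P _ H item win noise hrun
    refine ⟨hrun.integrable_runRegret hn (hT₀.trans_le hT) hB (d := h / 2) fun i j => ?_,
      fun w hw => ?_⟩
    · rw [abs_of_nonneg (by linarith [(hv i j).1])]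
      exact (hv i j).2
    · refine (hrun.integral_runRegret_le_regretConst hn hm hl hδ hT₀ hT hB hs hv hε hw).trans ?_
      have h1 := FairDivision.constDA_nonneg (B := B) hl hδ hw
      have h2 := Real.log_natCast_nonneg T
      rw [pow_one]
      gcongr
      linarith [le_abs_self (FairDivision.regretConst l h σ),
        abs_nonneg (FairDivision.regretConst l h σ)]
  · intro n m hn hm δ₀ hδ B _ w hw q ε hε
    exact FairDivision.eventually_mul_sqrt_le hn hm
      (mul_nonneg (Nat.cast_nonneg n) (FairDivision.constDA_nonneg hl hδ hw)) q hε
  · intro n m hn hm δ₀ hδ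
    -- The threshold for `T` must not depend on the values, so the case `h < l`, in which no
    -- admissible values exist, is split off beforehand. Otherwise `w = l` serves as the free
    -- parameter.
    by_cases hlh : l ≤ h
    · have hw : l ∈ Set.Icc l h := ⟨le_rfl, hlh⟩
      have hC := FairDivision.constDA_nonneg (B := fun _ : Fin n => (1 / n : ℝ)) hl hδ hw
      filter_upwards [FairDivision.eventually_explorationLength hn hm (le_max_left 1 (σ ^ 2))
          (show 0 < min 1 (2 * l) / 2 by positivity),
        FairDivision.eventually_mul_sqrt_le hn hm (mul_nonneg (Nat.cast_nonneg n) hC) 0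
          one_pos] with T hT₁ hT₂ T₀ hround B s v hB hs hv Ω _ P _ H item win noise hrun
      obtain ⟨hT₀, hT, hε, hbal⟩ := hT₁ T₀ hround
      refine ⟨hrun.integrable_runRegret hn (hT₀.trans_le hT) hB (d := h / 2) fun i j => ?_, ?_⟩
      · rw [abs_of_nonneg (by linarith [(hv i j).1])]
        exact (hv i j).2
      · refine (hrun.integral_runRegret_le_regretConst hn hm hl hδ hT₀ hT hB hs hv hε hw).trans ?_
        obtain rfl : B = fun _ => (1 / n : ℝ) := funext hB
        have h1 := hT₂ T₀ hT₀
        rw [pow_zero, one_mul, one_mul] at h1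
        have h2 := Real.log_natCast_nonneg T
        rw [pow_one]
        set A := (T : ℝ) ^ (2 / 3 : ℝ) * (n * m : ℝ) ^ (1 / 3 : ℝ) with hA
        have hA0 : 0 ≤ A := by positivity
        calc _ ≤ |FairDivision.regretConst l h σ| * (1 + Real.log T) * (8 * A) := by
              gcongr
              · exact le_abs_self _
              · linarith
          _ = 8 * |FairDivision.regretConst l h σ| * (1 + Real.log T) * A := by ring
          _ ≤ _ := by
              gcongr
              linarith
    · refine Eventually.of_forall fun T T₀ _ B s v _ _ hv => ?_
      have := hv ⟨0, hn⟩ ⟨0, hm⟩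
      exact absurd (show l ≤ h by linarith) hlh
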